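/- Let $\mathbb T=\mathbb R/\mathbb Z$ with Lebesgue measure $\mathcal L_{\mathbb T}$, $\Omega_1=\mathbb T\times\{-1,1\}$, $\iota(x,v)=(x,-v)$, $\pi=\mathcal L_{\mathbb T}\otimes\mathrm{Unif}_{\{-1,1\}}$, and fix $T>0$, $\alpha>0$. $\mathcal M$ and $\mathcal P$ denote finite signed Borel measures and Borel probability measures, with the narrow topology (duality with bounded continuous functions). A pair $(\sigma,j)$ belongs to $\mathrm{CE}(0,T;\Omega_1)$ if $\sigma\in C([0,T];\mathcal P(\Omega_1))$, $(j_t)_{t\in(0,T)}=(j^1_t,j^2_t)_{t\in(0,T)}\subset\mathcal M(\Omega_1;\mathbb R^2)$ is a measurable family with $\int_0^T\|j_t\|_{TV}\,dt<\infty$, and for all $\varphi\in C^{1,0}(\Omega_1)$ and $0\le s\le t\le T$ $$\int\varphi\,d\sigma_t-\int\varphi\,d\sigma_s=\int_s^t\Bigl(\int_{\Omega_1}\partial_x\varphi\,dj^1_r+\int_{\Omega_1}(\varphi\circ\iota-\varphi)\,dj^2_r\Bigr)dr .$$ For $V\ge 1$ let $\mathscr I^V(\sigma,j)=\int_0^T\mathscr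 L^V(\sigma_t,j_t)\,dt$ if $(\sigma,j)\in\mathrm{CE}(0,T;\Omega_1)$ and $+\infty$ otherwise, where $\mathscr L^V(\sigma,j)=\mathrm{Ent}\bigl(j^2\,\big|\,\tfrac{V^2}{2\alpha}\sigma\bigr)$ if $j^1=Vv\,\sigma$ and $+\infty$ otherwise. Here $\mathrm{Ent}(\mu|\nu)=\int(f\log f-f+1)\,d\nu$ if $\mu\ge 0$ and $\mu\ll\nu$ with $f=d\mu/d\nu$, and $+\infty$ otherwise. Let $V_n\ge1$ with $V_n\to\infty$ and let $(\sigma^n,j^n)\in\mathrm{CE}(0,T;\Omega_1)$ satisfy $$\sup_n\bigl\{\mathrm{Ent}(\sigma^n_0|\pi)+\mathscr I^{V_n}(\sigma^n,j^n)\bigr\}<\infty .$$ Put $\rho^n_t(dx)=\sum_{v=\pm1}\sigma^n_t(dx,v)$, $\omega^n_t(dx)=V_n\sum_{v=\pm1}v\,\sigma^n_t(dx,v)$, $J^n_t(dx)=\sum_{v=\pm1}\frac v{V_n}j^{2,n}_t(dx,v)$, and $\rho^n(dt\,dx)=\rho^n_t(dx)\,dt$, $\omega^n(dt\,dx)=\omega^n_t(dx)\,dt$,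 $J^n(dt\,dx)=J^n_t(dx)\,dt$ in $\mathcal M((0,T)\times\mathbb T)$. Assume that $\rho^n\to\bar\rho=\bar\rho_t(dx)\,dt$, $\omega^n\to\bar\omega$ and $J^n\to\bar J$ narrowly in $\mathcal M((0,T)\times\mathbb T)$, and $\rho^n_t\to\bar\rho_t$ narrowly in $\mathcal P(\mathbb T)$ for every $t\in[0,T]$. Then $\bar J$ has a density in time: there is a measurable family $(\bar J_t)_{t\in(0,T)}\subset\mathcal M(\mathbb T)$ with $\int_0^T\|\bar J_t\|_{TV}\,dt<\infty$ and $\bar J(dt\,dx)=\bar J_t(dx)\,dt$. For every such family and for almost every $t\in(0,T)$, $$\int_{\mathbb T}\partial_x\psi\,d\bar\rho_t-2\int_{\mathbb T}\psi\,d\bar J_t=0\qquad\text{for all }\psi\in C^1(\mathbb T).$$ Moreover, for almost every $t\in(0,T)$, $\bar\rho_t\ll\mathcal L_{\mathbb T}$, and the density $\bar u_t=d\bar\rho_t/d\mathcal L_{\mathbb T}$ has distributional derivative $D\bar u_t=-2\bar J_t$. In particular $\bar u_t\in BV(\mathbb T)$, i.e. $\bar u_t\in L^1(\mathbb T)$ and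 its distributional derivative is a finite signed measure. -/

import Mathlib

open MeasureTheory Set Filter Topology
open scoped ENNReal BigOperators

noncomputable section

namespace KacDiffusive

/-! ### Measures on `(0,T) × X` with a density in time -/

section TimeIntegral

variable {X : Type*} [MeasurableSpace X]

/-- A family `(m_t)` of finite signed measures, of which only the times `t ∈ (0,T)` matter, is
measurable if `t ↦ m_t(B)` is measurable on `(0,T)` for every measurable set `B`. -/
def IsMeasurableFamily (T : ℝ) (m : ℝ → SignedMeasure X) : Prop :=
  ∀ B : Set X, MeasurableSet B → Measurable fun t : Ioo (0 : ℝ) T => m t B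

/-- Lebesgue measure on `(0,T)`. -/
def timeMeasure (T : ℝ) : Measure (Ioo (0 : ℝ) T) := (volume : Measure ℝ).comap Subtype.val

/-- A measurable family with `∫₀ᵀ ‖m_t‖_TV dt < ∞`. -/
def IsIntegrableFamily (T : ℝ) (m : ℝ → SignedMeasure X) : Prop :=
  IsMeasurableFamily T m ∧ ∫⁻ t in Ioo (0 : ℝ) T, (m t).variation univ < ∞

lemma IsMeasurableFamily.measurable_section {T : ℝ} {m : ℝ → SignedMeasure X}
    (hm : IsMeasurableFamily T m) {B : Set (Ioo (0 : ℝ) T × X)} (hB : MeasurableSet B) :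
    Measurable fun t : Ioo (0 : ℝ) T => m t (Prod.mk t ⁻¹' B) := by
  induction B, hB using MeasurableSpace.induction_on_inter generateFrom_prod.symm
    isPiSystem_prod with
  | empty => simp
  | basic B hB =>
    obtain ⟨s, hs, u, hu, rfl⟩ := hB
    have : (fun t : Ioo (0 : ℝ) T => m t (Prod.mk t ⁻¹' s ×ˢ u))
        = s.indicator fun t : Ioo (0 : ℝ) T => m t u := by
      ext t
      by_cases ht : t ∈ s
      · rw [mk_preimage_prod_right ht, indicator_of_mem ht]
      · rw [mk_preimage_prod_right_eq_empty ht, indicator_of_notMem ht, VectorMeasure.empty]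
    rw [this]
    exact (hm u hu).indicator hs
  | compl B hB ih =>
    have : (fun t : Ioo (0 : ℝ) T => m t (Prod.mk t ⁻¹' Bᶜ))
        = fun t : Ioo (0 : ℝ) T => m t univ - m t (Prod.mk t ⁻¹' B) := by
      ext t
      rw [preimage_compl, ← VectorMeasure.of_add_of_sdiff (v := m t)
        (measurable_prodMk_left hB) MeasurableSet.univ (subset_univ _), compl_eq_univ_sdiff]
      ring
    rw [this]
    exact (hm univ MeasurableSet.univ).sub ih
  | iUnion f hd hf ih =>
    have : (fun t : Ioo (0 : ℝ) T => m t (Prod.mk t ⁻¹' ⋃ i, f i))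
        = fun t : Ioo (0 : ℝ) T => ∑' i, m t (Prod.mk t ⁻¹' f i) := by
      ext t
      rw [preimage_iUnion]
      exact VectorMeasure.of_disjoint_iUnion (fun i => measurable_prodMk_left (hf i))
        fun i j hij => (hd hij).preimage _
    rw [this]
    exact Measurable.tsum ih

lemma IsIntegrableFamily.hasSum {T : ℝ} {m : ℝ → SignedMeasure X}
    (hm : IsIntegrableFamily T m) {f : ℕ → Set (Ioo (0 : ℝ) T × X)}
    (hf : ∀ i, MeasurableSet (f i)) (hd : Pairwise (Function.onFun Disjoint f)) :
    HasSum (fun i => ∫ t, m (t : ℝ) (Prod.mk t ⁻¹' f i) ∂timeMeasure T)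
      (∫ t, m (t : ℝ) (Prod.mk t ⁻¹' ⋃ i, f i) ∂timeMeasure T) := by
  have hmeas : ∀ i, Measurable fun t : Ioo (0 : ℝ) T => m t (Prod.mk t ⁻¹' f i) :=
    fun i => hm.1.measurable_section (hf i)
  have hsum : ∑' i, ∫⁻ t, ‖m (t : ℝ) (Prod.mk t ⁻¹' f i)‖ₑ ∂timeMeasure T < ∞ := by
    rw [← lintegral_tsum fun i => (hmeas i).enorm.aemeasurable]
    have h2 : ∫⁻ t, (m (t : ℝ)).variation univ ∂timeMeasure T < ∞ := by
      rw [timeMeasure, lintegral_subtype_comap measurableSet_Ioo fun t => (m t).variation univ]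
      exact hm.2
    refine lt_of_le_of_lt (lintegral_mono fun t => ?_) h2
    calc ∑' i, ‖m t (Prod.mk t ⁻¹' f i)‖ₑ
        ≤ ∑' i, (m t).variation (Prod.mk t ⁻¹' f i) :=
          ENNReal.tsum_le_tsum fun i => VectorMeasure.enorm_measure_le_variation _ _
      _ = (m t).variation (⋃ i, Prod.mk t ⁻¹' f i) :=
          (measure_iUnion (fun i j hij => (hd hij).preimage _)
            fun i => measurable_prodMk_left (hf i)).symm
      _ ≤ (m t).variation univ := measure_mono (subset_univ _)
  have hint : ∀ i, Integrable (fun t : Ioo (0 : ℝ) T => m t (Prod.mk t ⁻¹' f i)) (timeMeasure T) :=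
    fun i => ⟨(hmeas i).aestronglyMeasurable, lt_of_le_of_lt (ENNReal.le_tsum i) hsum⟩
  have hsum' : Summable fun i => ∫ t, ‖m (t : ℝ) (Prod.mk t ⁻¹' f i)‖ ∂timeMeasure T := by
    have := ENNReal.summable_toReal hsum.ne
    refine this.congr fun i => ?_
    rw [integral_norm_eq_lintegral_enorm (hint i).1]
  have key : ∀ t : Ioo (0 : ℝ) T,
      m t (Prod.mk t ⁻¹' ⋃ i, f i) = ∑' i, m t (Prod.mk t ⁻¹' f i) := by
    intro t
    rw [preimage_iUnion]
    exact VectorMeasure.of_disjoint_iUnion (fun i => measurable_prodMk_left (hf i))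
      fun i j hij => (hd hij).preimage _
  simp_rw [key]
  exact hasSum_integral_of_summable_integral_norm hint hsum'

open Classical in
/-- The signed measure `m_t(dx) dt` on `(0,T) × X`, i.e. `B ↦ ∫₀ᵀ m_t({x | (t,x) ∈ B}) dt`, for an
integrable family `(m_t)`; it is `0` by convention for other families. -/
def timeIntegral (T : ℝ) (m : ℝ → SignedMeasure X) : SignedMeasure (Ioo (0 : ℝ) T × X) :=
  if hm : IsIntegrableFamily T m then
    { measureOf' := fun B =>
        if MeasurableSet B then ∫ t, m (t : ℝ) (Prod.mk t ⁻¹' B) ∂timeMeasure T else 0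
      empty' := by simp
      not_measurable' := fun _ hB => if_neg hB
      m_iUnion' := fun f hf hd => by
        simp only [hf, MeasurableSet.iUnion hf, if_true]
        exact hm.hasSum hf hd }
  else 0

lemma timeIntegral_apply {T : ℝ} {m : ℝ → SignedMeasure X} (hm : IsIntegrableFamily T m)
    {B : Set (Ioo (0 : ℝ) T × X)} (hB : MeasurableSet B) :
    timeIntegral T m B = ∫ t, m (t : ℝ) (Prod.mk t ⁻¹' B) ∂timeMeasure T := by
  rw [timeIntegral, dif_pos hm]
  exact if_pos hB

/-- Narrow convergence of finite signed measures: convergence against all bounded continuous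
functions. -/
def NarrowTendsto [TopologicalSpace X] (μ : ℕ → SignedMeasure X) (ν : SignedMeasure X) : Prop :=
  ∀ f : BoundedContinuousFunction X ℝ,
    Tendsto (fun n => ∫ᵛ x, f x ∂•(μ n)) atTop (𝓝 (∫ᵛ x, f x ∂•ν))

end TimeIntegral

/-! ### The torus `𝕋 = ℝ/ℤ` and the state space `Ω₁ = 𝕋 × {-1,1}` -/

/-- `ψ ∈ C¹(𝕋)`: the `1`-periodic lift of `ψ` to `ℝ` is `C¹`. -/
def IsC1 (ψ : UnitAddCircle → ℝ) : Prop :=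
  ContDiff ℝ 1 fun s : ℝ => ψ (s : UnitAddCircle)

/-- The derivative `∂ₓψ` of a function on the torus. -/
def torusDeriv (ψ : UnitAddCircle → ℝ) (x : UnitAddCircle) : ℝ :=
  deriv (fun s : ℝ => ψ (x + (s : UnitAddCircle))) 0

/-- The velocity space `{-1,1}`. -/
abbrev Vel : Type := ({-1, 1} : Set ℝ)

/-- The state space `Ω₁ = 𝕋 × {-1,1}`. -/
abbrev Omega : Type := UnitAddCircle × Vel

/-- Reversal of the velocity. -/
def Vel.rev (v : Vel) : Vel :=
  ⟨-(v : ℝ), by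
    obtain ⟨v, hv | hv⟩ := v
    · exact Or.inr (by simp [hv])
    · exact Or.inl (by simpa using hv)⟩

/-- The invariant measure `π = 𝓛_𝕋 ⊗ Unif{-1,1}`. -/
def statMeasure : Measure Omega :=
  (volume : Measure UnitAddCircle).prod (ProbabilityTheory.uniformOn (univ : Set Vel))

/-- The signed measure on the torus `m(dx, v)`, i.e. `B ↦ m(B × {v})`, for a signed measure `m`
on `Ω₁`. -/
def slice (m : SignedMeasure Omega) (v : Vel) : SignedMeasure UnitAddCircle :=
  (m.restrict (univ ×ˢ {v})).map Prod.fst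

lemma slice_apply (m : SignedMeasure Omega) (v : Vel) {B : Set UnitAddCircle}
    (hB : MeasurableSet B) : slice m v B = m (B ×ˢ {v}) := by
  have hv : MeasurableSet ((univ : Set UnitAddCircle) ×ˢ ({v} : Set Vel)) :=
    MeasurableSet.univ.prod (measurableSet_singleton v)
  rw [slice, VectorMeasure.map_apply _ measurable_fst hB,
    VectorMeasure.restrict_apply _ hv (measurable_fst hB)]
  congr 1
  ext ⟨x, w⟩
  simp

/-- Curves of probability measures seen as curves of signed measures. -/
def toSigned {X : Type*} [MeasurableSpace X] (μ : ProbabilityMeasure X) : SignedMeasure X :=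
  (μ : Measure X).toSignedMeasure

/-! ### Continuity equation, rate functional -/

/-- A flux `j = (j¹, j²)`: a pair of finite signed measures on `Ω₁`. -/
abbrev Flux : Type := SignedMeasure Omega × SignedMeasure Omega

/-- Total variation norm `sup {∫ φ · dj : φ ∈ C(Ω₁;ℝ²), |φ₁|, |φ₂| ≤ 1}` of a flux, which is the
sum of the total variations of the components. -/
def Flux.tvNorm (j : Flux) : ℝ≥0∞ := j.1.variation univ + j.2.variation univ

/-- `φ ∈ C^{1,0}(Ω₁)`: continuously differentiable in the space variable (the velocity space is
finite and discrete). -/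
def IsC10 (φ : Omega → ℝ) : Prop := ∀ v : Vel, IsC1 fun x => φ (x, v)

/-- The pairing `⟨(∂ₓφ, φ ∘ ι - φ), j⟩`, where `ι(x,v) = (x,-v)`. -/
def gradPairing (φ : Omega → ℝ) (j : Flux) : ℝ :=
  (∫ᵛ p, torusDeriv (fun x => φ (x, p.2)) p.1 ∂•j.1)
    + ∫ᵛ p, (φ (p.1, p.2.rev) - φ p) ∂•j.2

/-- The continuity equation `∂ₜσ + div j = 0` on `Ω₁`; only the values of `σ` on `[0,T]` and of `j`
on `(0,T)` matter. -/
structure ContinuityEq (T : ℝ) (σ : ℝ → ProbabilityMeasure Omega) (j : ℝ → Flux) : Prop where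
  continuousOn : ContinuousOn σ (Icc 0 T)
  measurable_fst : IsMeasurableFamily T fun t => (j t).1
  measurable_snd : IsMeasurableFamily T fun t => (j t).2
  integrable : ∫⁻ t in Ioo (0 : ℝ) T, (j t).tvNorm < ∞
  weak : ∀ φ : Omega → ℝ, IsC10 φ → ∀ s t : ℝ, 0 ≤ s → s ≤ t → t ≤ T →
    (∫ p, φ p ∂(σ t : Measure Omega)) - ∫ p, φ p ∂(σ s : Measure Omega)
      = ∫ r in s..t, gradPairing φ (j r)

open Classical in
/-- Relative entropy `Ent(μ | ν) = ∫ (f log f - f + 1) dν` with `f = dμ/dν` if `μ ≪ ν`, and `+∞`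
otherwise, of a signed measure `μ`: it is `+∞` unless `μ` is nonnegative. (For finite measures
Mathlib's `klDiv` is exactly this integral.) -/
def signedEnt {X : Type*} [MeasurableSpace X] (μ : SignedMeasure X) (ν : Measure X) : ℝ≥0∞ :=
  if 0 ≤ μ then InformationTheory.klDiv μ.toJordanDecomposition.posPart ν else ∞

open Classical in
/-- The Lagrangian `𝓛^V(σ, j)`: `Ent(j² | V²/(2α) σ)` if `j¹ = V v σ`, and `+∞` otherwise. -/
def lagrangian (α V : ℝ) (σ : ProbabilityMeasure Omega) (j : Flux) : ℝ≥0∞ :=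
  if j.1 = (σ : Measure Omega).withDensityᵥ (fun p => V * (p.2 : ℝ)) then
    signedEnt j.2 (ENNReal.ofReal (V ^ 2 / (2 * α)) • (σ : Measure Omega))
  else ∞

open Classical in
/-- The rate functional `𝓘^V(σ, j)`. -/
def rateFunctional (α T V : ℝ) (σ : ℝ → ProbabilityMeasure Omega) (j : ℝ → Flux) : ℝ≥0∞ :=
  if ContinuityEq T σ j then ∫⁻ t in Ioo (0 : ℝ) T, lagrangian α V (σ t) (j t) else ∞

/-! ### The density, the flux, and the derived flux -/

/-- `ρ_t(dx) = ∑_v σ_t(dx, v)`. -/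
def density (σ : ProbabilityMeasure Omega) : ProbabilityMeasure UnitAddCircle :=
  σ.map measurable_fst.aemeasurable

/-- `ω_t(dx) = V ∑_v v σ_t(dx, v)`. -/
def fluxOf (V : ℝ) (σ : ProbabilityMeasure Omega) : SignedMeasure UnitAddCircle :=
  V • ∑ v : Vel, (v : ℝ) • slice (toSigned σ) v

/-- `J_t(dx) = ∑_v (v / V) j²_t(dx, v)`. -/
def derivedFlux (V : ℝ) (j : Flux) : SignedMeasure UnitAddCircle :=
  ∑ v : Vel, ((v : ℝ) / V) • slice j.2 v

/-! ### Distributional derivatives and functions of bounded variation on the torus -/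

/-- `Du = μ` in the sense of distributions on the torus. -/
def HasDistribDeriv (u : UnitAddCircle → ℝ) (μ : SignedMeasure UnitAddCircle) : Prop :=
  ∀ ψ : UnitAddCircle → ℝ, IsC1 ψ → ∫ x, torusDeriv ψ x * u x = -∫ᵛ x, ψ x ∂•μ

/-- `u ∈ BV(𝕋)`: `u` is integrable and its distributional derivative is a finite signed
measure. -/
def IsBV (u : UnitAddCircle → ℝ) : Prop :=
  Integrable u ∧ ∃ μ : SignedMeasure UnitAddCircle, HasDistribDeriv u μ

/-- The Lebesgue density `dρ/d𝓛_𝕋`. -/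
def lebDensity (ρ : ProbabilityMeasure UnitAddCircle) (x : UnitAddCircle) : ℝ :=
  ((ρ : Measure UnitAddCircle).rnDeriv volume x).toReal

end KacDiffusive

end

noncomputable section

namespace KacDiffusive

/-! ### Integration against signed measures -/

section Signed

variable {X Y : Type*} [MeasurableSpace X] [MeasurableSpace Y]

/-! The continuity equation is tested with `φ(x,v) = v ψ(x)`, which is odd under velocity reversal,
so `φ ∘ ι - φ = -2φ`. Finite action forces `j¹ = V v σ` for almost every time. Since `v² = 1`, the
right-hand side of the equation then has integrand `V (∫ ∂ₓψ dρ_t - 2 ∫ ψ dJ_t)`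
(`ae_gradPairing_eq`). The left-hand side is a difference of two averages of `φ`, hence at most `2
sup |ψ|`. After division by `V`, the bracket has a time primitive of size `O(1/V)`, and integration
by parts carries this bound to every weight `η ∈ C¹` (`abs_integral_weak_le`). Letting `V_n → ∞`
yields `∫ η ψ dJ̄ = ½ ∫ η(t) ∫ ∂ₓψ dρ̄_t dt` (`integral_limit_eq`).

By density of `C¹` weights, the time marginal of the signed measure `ψ J̄` is `½ (∫ ∂ₓψ dρ̄_t) dt`
(`integral_indicator_mul_eq`). For a null set `A` of times, `J̄(A × ·)` therefore annihilates every
`C¹` function and vanishes, so `J̄` can be disintegrated over `dt` (`exists_timeIntegral_eq`). For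
any version of the density, the identity `∫ ∂ₓψ dρ̄_t = 2 ∫ ψ dJ̄_t` holds almost everywhere in time
for each `ψ`. Separability of `C¹` makes the exceptional null set independent of `ψ`
(`exists_countable_c1`).

At a good time, `ρ̄_t` is a probability measure whose distributional derivative is a finite measure.
Testing with the periodic primitive of `f - ∫ f`, for continuous `f ≥ 0`, gives `∫ f dρ̄_t ≤ K ∫ f
dx`, and so absolute continuity (`absolutelyContinuous_of_deriv`). The derivative of the Lebesgue
density is then read off from the same identity. -/

instance isFiniteMeasure_variation (ν : SignedMeasure X) :
    IsFiniteMeasure (VectorMeasure.variation ν) := by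
  rw [← SignedMeasure.totalVariation_eq_variation]
  unfold SignedMeasure.totalVariation
  infer_instance

lemma integrable_of_bounded {μ : Measure X} [IsFiniteMeasure μ] {f : X → ℝ} (hf : Measurable f)
    {C : ℝ} (hC : ∀ x, ‖f x‖ ≤ C) : Integrable f μ :=
  Integrable.of_bound hf.aestronglyMeasurable C (Eventually.of_forall hC)

/-- A property of bounded measurable functions that holds for indicators and is stable under sums
and bounded pointwise limits holds for all bounded measurable functions. -/
theorem bounded_measurable_induction {P : (X → ℝ) → Prop}
    (ind : ∀ (c : ℝ) (s : Set X), MeasurableSet s → P (s.indicator fun _ => c))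
    (add : ∀ (f g : X → ℝ) (C D : ℝ), Measurable f → Measurable g → (∀ x, ‖f x‖ ≤ C) →
      (∀ x, ‖g x‖ ≤ D) → P f → P g → P (fun x => f x + g x))
    (lim : ∀ (F : ℕ → X → ℝ) (f : X → ℝ) (C : ℝ), (∀ n, Measurable (F n)) → Measurable f →
      (∀ n x, ‖F n x‖ ≤ C) → (∀ x, Tendsto (fun n => F n x) atTop (𝓝 (f x))) →
      (∀ n, P (F n)) → P f)
    {f : X → ℝ} (hf : Measurable f) {C : ℝ} (hC : ∀ x, ‖f x‖ ≤ C) : P f := by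
  have hsimple : ∀ g : SimpleFunc X ℝ, P g := by
    intro g
    induction g using SimpleFunc.induction with
    | const c hs =>
      convert ind c _ hs using 1
      ext x
      simp [indicator, piecewise]
    | add hd hf hg =>
      rename_i f g
      obtain ⟨C, hC⟩ := SimpleFunc.exists_forall_norm_le f
      obtain ⟨D, hD⟩ := SimpleFunc.exists_forall_norm_le g
      exact add f g C D f.measurable g.measurable hC hD hf hg
  -- The truncation level must be nonnegative, while `C` may be negative when `X` is empty.
  have hC0 : 0 ≤ |C| := abs_nonneg C
  have hC' : ∀ x, ‖f x‖ ≤ |C| := fun x => (hC x).trans (le_abs_self C)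
  exact lim (fun n => hf.stronglyMeasurable.approxBounded |C| n) f |C|
    (fun n => SimpleFunc.measurable _) hf
    (fun n x => hf.stronglyMeasurable.norm_approxBounded_le hC0 n x)
    (fun x => hf.stronglyMeasurable.tendsto_approxBounded_of_norm_le (hC' x))
    fun n => hsimple _

lemma integral_signed_indicator_const (ν : SignedMeasure X) (c : ℝ) {s : Set X}
    (hs : MeasurableSet s) : ∫ᵛ x, s.indicator (fun _ => c) x ∂•ν = c * ν s := by
  rw [VectorMeasure.integral_indicator hs, VectorMeasure.integral_const]
  simp [VectorMeasure.restrict_apply, hs]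

lemma tendsto_integral_signed (ν : SignedMeasure X) {F : ℕ → X → ℝ} {f : X → ℝ} {C : ℝ}
    (hF : ∀ n, Measurable (F n)) (hC : ∀ n x, ‖F n x‖ ≤ C)
    (hlim : ∀ x, Tendsto (fun n => F n x) atTop (𝓝 (f x))) :
    Tendsto (fun n => ∫ᵛ x, F n x ∂•ν) atTop (𝓝 (∫ᵛ x, f x ∂•ν)) :=
  VectorMeasure.tendsto_integral_of_dominated_convergence (fun _ => C)
    (fun n => (hF n).aestronglyMeasurable) (integrable_const _)
    (fun n => Eventually.of_forall (hC n)) (Eventually.of_forall hlim)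

lemma norm_integral_signed_le (ν : SignedMeasure X) {f : X → ℝ} {C : ℝ} (hC : ∀ x, ‖f x‖ ≤ C) :
    ‖∫ᵛ x, f x ∂•ν‖ ≤ C * (VectorMeasure.variation ν).real univ := by
  have h := VectorMeasure.norm_integral_le_of_norm_le_const (μ := ν)
    (B := ContinuousLinearMap.lsmul ℝ ℝ) (f := f) (Eventually.of_forall hC)
  simpa using h

lemma integral_toSignedMeasure_lsmul (μ : Measure X) [IsFiniteMeasure μ] (f : X → ℝ) :
    ∫ᵛ x, f x ∂•μ.toSignedMeasure = ∫ x, f x ∂μ := by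
  rw [← VectorMeasure.integral_toSignedMeasure]
  congr 1
  ext
  simp

lemma integral_signed_eq_sub (ν : SignedMeasure X) {f : X → ℝ} (hf : Measurable f) {C : ℝ}
    (hC : ∀ x, ‖f x‖ ≤ C) :
    ∫ᵛ x, f x ∂•ν = (∫ x, f x ∂ν.toJordanDecomposition.posPart)
      - ∫ x, f x ∂ν.toJordanDecomposition.negPart := by
  conv_lhs => rw [← ν.toSignedMeasure_toJordanDecomposition]
  rw [JordanDecomposition.toSignedMeasure, VectorMeasure.integral_sub_vectorMeasure
    (integrable_of_bounded hf hC) (integrable_of_bounded hf hC),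
    integral_toSignedMeasure_lsmul, integral_toSignedMeasure_lsmul]

/-- If `ν` has density `g` with respect to `μ` then `∫ f dν = ∫ f g dμ`. -/
lemma integral_signed_of_density {ν : SignedMeasure X} {μ : Measure X} {g : X → ℝ}
    (hg : Integrable g μ) (h : ∀ s, MeasurableSet s → ν s = ∫ x in s, g x ∂μ)
    {f : X → ℝ} (hf : Measurable f) {C : ℝ} (hC : ∀ x, ‖f x‖ ≤ C) :
    ∫ᵛ x, f x ∂•ν = ∫ x, f x * g x ∂μ := by
  refine bounded_measurable_induction
    (P := fun f => ∫ᵛ x, f x ∂•ν = ∫ x, f x * g x ∂μ) ?_ ?_ ?_ hf hC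
  · intro c s hs
    rw [integral_signed_indicator_const ν c hs, h s hs, ← integral_indicator hs,
      ← integral_const_mul]
    congr with x
    by_cases hx : x ∈ s <;> simp [hx]
  · intro f₁ f₂ C D hf₁ hf₂ hC hD h₁ h₂
    rw [VectorMeasure.integral_fun_add (integrable_of_bounded hf₁ hC)
      (integrable_of_bounded hf₂ hD), h₁, h₂, ← integral_add]
    · simp_rw [add_mul]
    · exact hg.bdd_mul hf₁.aestronglyMeasurable (Eventually.of_forall hC)
    · exact hg.bdd_mul hf₂.aestronglyMeasurable (Eventually.of_forall hD)
  · intro F f C hF hf hC hlim hP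
    refine tendsto_nhds_unique (tendsto_integral_signed ν hF hC hlim) ?_
    simp_rw [hP]
    refine tendsto_integral_of_dominated_convergence (fun x => C * ‖g x‖)
      (fun n => (hF n).aestronglyMeasurable.mul hg.1) (hg.norm.const_mul C)
      (fun n => Eventually.of_forall fun x => ?_)
      (Eventually.of_forall fun x => (hlim x).mul_const _)
    rw [norm_mul]
    exact mul_le_mul_of_nonneg_right (hC n x) (norm_nonneg _)

/-- A star subalgebra of bounded continuous functions that separates points separates finite
signed measures. -/
lemma signedMeasure_ext_of_subalgebra [TopologicalSpace X] [PolishSpace X] [BorelSpace X]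
    (A : StarSubalgebra ℝ (BoundedContinuousFunction X ℝ))
    (hA : ∀ x y : X, x ≠ y → ∃ f ∈ A, f x ≠ f y) {μ ν : SignedMeasure X}
    (h : ∀ f ∈ A, ∫ᵛ x, f x ∂•μ = ∫ᵛ x, f x ∂•ν) : μ = ν := by
  have hsep : (A.map (BoundedContinuousFunction.toContinuousMapStarₐ ℝ)).SeparatesPoints := by
    intro x y hxy
    simpa using hA x y hxy
  -- Moving the negative parts across turns `μ = ν` into an equality of two positive finite
  -- measures, to which the separation theorem for positive measures applies.
  have key : μ.toJordanDecomposition.posPart + ν.toJordanDecomposition.negPart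
      = ν.toJordanDecomposition.posPart + μ.toJordanDecomposition.negPart := by
    refine ext_of_forall_mem_subalgebra_integral_eq_of_polish hsep fun f hf => ?_
    have hm : Measurable f := f.continuous.measurable
    have hb : ∀ x, ‖f x‖ ≤ ‖f‖ := f.norm_coe_le_norm
    rw [integral_add_measure (integrable_of_bounded hm hb) (integrable_of_bounded hm hb),
      integral_add_measure (integrable_of_bounded hm hb) (integrable_of_bounded hm hb)]
    have := h f hf
    rw [integral_signed_eq_sub μ hm hb, integral_signed_eq_sub ν hm hb] at this
    linarith
  rw [← μ.toSignedMeasure_toJordanDecomposition, ← ν.toSignedMeasure_toJordanDecomposition]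
  have key' := (Measure.toSignedMeasure_congr key)
  rw [Measure.toSignedMeasure_add, Measure.toSignedMeasure_add] at key'
  rw [JordanDecomposition.toSignedMeasure, JordanDecomposition.toSignedMeasure,
    sub_eq_sub_iff_add_eq_add, key']

end Signed

/-! ### Fubini for families of signed measures -/

section Family

variable {X : Type*} [MeasurableSpace X] {T : ℝ} {m : ℝ → SignedMeasure X}

instance isFiniteMeasure_timeMeasure (T : ℝ) : IsFiniteMeasure (timeMeasure T) := by
  constructor
  rw [timeMeasure, (MeasurableEmbedding.subtype_coe measurableSet_Ioo).comap_apply]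
  refine (measure_mono (image_subset_iff.2 fun t _ => t.2)).trans_lt
    (measure_Ioo_lt_top (a := (0 : ℝ)) (b := T))

lemma integral_timeMeasure {E : Type*} [NormedAddCommGroup E] [NormedSpace ℝ E] (f : ℝ → E) :
    ∫ t, f t ∂timeMeasure T = ∫ t in Ioo 0 T, f t :=
  integral_subtype_comap measurableSet_Ioo f

lemma IsIntegrableFamily.lintegral_variation_lt_top (hm : IsIntegrableFamily T m) :
    ∫⁻ t, (m (t : ℝ)).variation univ ∂timeMeasure T < ∞ := by
  rw [timeMeasure, lintegral_subtype_comap measurableSet_Ioo fun t => (m t).variation univ]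
  exact hm.2

/-- Dominated convergence with a majorant that need not be measurable. -/
lemma tendsto_integral_of_enorm_le {S : Type*} [MeasurableSpace S] {μ : Measure S}
    {F : ℕ → S → ℝ} {f : S → ℝ} {v : S → ℝ≥0∞} (hF : ∀ n, AEStronglyMeasurable (F n) μ)
    (hv : ∀ n t, ‖F n t‖ₑ ≤ v t) (hfin : ∫⁻ t, v t ∂μ < ∞)
    (hlim : ∀ t, Tendsto (fun n => F n t) atTop (𝓝 (f t))) :
    Tendsto (fun n => ∫ t, F n t ∂μ) atTop (𝓝 (∫ t, f t ∂μ)) := by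
  -- The countable supremum of the `F n` is measurable and lies below `v`, so it can serve as the
  -- majorant in place of `v`.
  have hm : AEMeasurable (fun t => ⨆ n, ‖F n t‖ₑ) μ := AEMeasurable.iSup fun n => (hF n).enorm
  have hlt : ∫⁻ t, ⨆ n, ‖F n t‖ₑ ∂μ < ∞ :=
    (lintegral_mono fun t => iSup_le fun n => hv n t).trans_lt hfin
  refine tendsto_integral_of_dominated_convergence (fun t => (⨆ n, ‖F n t‖ₑ).toReal) hF
    (integrable_toReal_of_lintegral_ne_top hm hlt.ne) (fun n => ?_) (Eventually.of_forall hlim)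
  filter_upwards [ae_lt_top' hm hlt.ne] with t ht
  rw [← toReal_enorm]
  exact ENNReal.toReal_mono ht.ne (le_iSup (fun n => ‖F n t‖ₑ) n)

lemma enorm_integral_signed_le {X : Type*} [MeasurableSpace X] (ν : SignedMeasure X) {f : X → ℝ}
    {C : ℝ} (hC : ∀ x, ‖f x‖ ≤ C) :
    ‖∫ᵛ x, f x ∂•ν‖ₑ ≤ ENNReal.ofReal C * (VectorMeasure.variation ν) univ := by
  have hC0 : ENNReal.ofReal ‖∫ᵛ x, f x ∂•ν‖ ≤ _ :=
    ENNReal.ofReal_le_ofReal (norm_integral_signed_le ν hC)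
  rw [ofReal_norm] at hC0
  refine hC0.trans ?_
  by_cases h0 : 0 ≤ C
  · rw [ENNReal.ofReal_mul h0, ofReal_measureReal]
  · rw [ENNReal.ofReal_of_nonpos]
    · exact zero_le
    · exact mul_nonpos_of_nonpos_of_nonneg (not_le.1 h0).le measureReal_nonneg

lemma IsIntegrableFamily.integrable_of_measurable (hm : IsIntegrableFamily T m)
    {f : Ioo (0 : ℝ) T → X → ℝ}
    (hf : Measurable fun t : Ioo (0 : ℝ) T => ∫ᵛ x, f t x ∂•(m t)) {C : ℝ}
    (hC : ∀ t x, ‖f t x‖ ≤ C) :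
    Integrable (fun t : Ioo (0 : ℝ) T => ∫ᵛ x, f t x ∂•(m t)) (timeMeasure T) := by
  refine ⟨hf.aestronglyMeasurable,
    (lintegral_mono (g := fun t : Ioo (0 : ℝ) T => ENNReal.ofReal C * (m t).variation univ)
      fun t => enorm_integral_signed_le (m t) (hC t)).trans_lt ?_⟩
  rw [lintegral_const_mul' _ _ ENNReal.ofReal_ne_top]
  exact ENNReal.mul_lt_top ENNReal.ofReal_lt_top hm.lintegral_variation_lt_top

/-- Both conclusions go through one induction because the additive and limit steps of the Fubini
identity need the measurability in time of the inner integrals. -/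
lemma measurable_integral_and_integral_timeIntegral (hm : IsIntegrableFamily T m) {f : Ioo (0 : ℝ) T × X → ℝ}
    (hf : Measurable f) {C : ℝ} (hC : ∀ p, ‖f p‖ ≤ C) :
    Measurable (fun t : Ioo (0 : ℝ) T => ∫ᵛ x, f (t, x) ∂•(m t)) ∧
      ∫ᵛ p, f p ∂•(timeIntegral T m)
        = ∫ t : Ioo (0 : ℝ) T, ∫ᵛ x, f (t, x) ∂•(m t) ∂timeMeasure T := by
  refine bounded_measurable_induction
    (P := fun f => Measurable (fun t : Ioo (0 : ℝ) T => ∫ᵛ x, f (t, x) ∂•(m t)) ∧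
      ∫ᵛ p, f p ∂•(timeIntegral T m)
        = ∫ t : Ioo (0 : ℝ) T, ∫ᵛ x, f (t, x) ∂•(m t) ∂timeMeasure T) ?_ ?_ ?_ hf hC
  · intro c s hs
    have : ∀ t : Ioo (0 : ℝ) T, ∫ᵛ x, s.indicator (fun _ => c) (t, x) ∂•(m t)
        = c * m t (Prod.mk t ⁻¹' s) := fun t => by
      rw [← integral_signed_indicator_const _ _ (measurable_prodMk_left hs)]
      rfl
    simp_rw [this]
    refine ⟨(hm.1.measurable_section hs).const_mul c, ?_⟩
    rw [integral_signed_indicator_const _ _ hs, timeIntegral_apply hm hs, integral_const_mul]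
  · intro f₁ f₂ C D hf₁ hf₂ hC hD h₁ h₂
    have : ∀ t : Ioo (0 : ℝ) T, ∫ᵛ x, (f₁ (t, x) + f₂ (t, x)) ∂•(m t)
        = (∫ᵛ x, f₁ (t, x) ∂•(m t)) + ∫ᵛ x, f₂ (t, x) ∂•(m t) := fun t =>
      VectorMeasure.integral_fun_add
        (integrable_of_bounded (hf₁.comp measurable_prodMk_left) fun x => hC _)
        (integrable_of_bounded (hf₂.comp measurable_prodMk_left) fun x => hD _)
    simp_rw [this]
    refine ⟨h₁.1.add h₂.1, ?_⟩
    rw [VectorMeasure.integral_fun_add (integrable_of_bounded hf₁ hC)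
      (integrable_of_bounded hf₂ hD), h₁.2, h₂.2, integral_add]
    · exact hm.integrable_of_measurable h₁.1 fun t x => hC (t, x)
    · exact hm.integrable_of_measurable h₂.1 fun t x => hD (t, x)
  · intro F f C hF hf hC hlim hP
    have hlim' : ∀ t : Ioo (0 : ℝ) T, Tendsto (fun n => ∫ᵛ x, F n (t, x) ∂•(m t)) atTop
        (𝓝 (∫ᵛ x, f (t, x) ∂•(m t))) := fun t =>
      tendsto_integral_signed _ (fun n => (hF n).comp measurable_prodMk_left)
        (fun n x => hC n _) fun x => hlim _
    refine ⟨measurable_of_tendsto_metrizable (fun n => (hP n).1) (tendsto_pi_nhds.2 hlim'),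
      tendsto_nhds_unique (tendsto_integral_signed _ hF hC hlim) ?_⟩
    simp_rw [(hP _).2]
    refine tendsto_integral_of_enorm_le (fun n => (hP n).1.aestronglyMeasurable)
      (fun n t => enorm_integral_signed_le (m t) fun x => hC n (t, x)) ?_ hlim'
    rw [lintegral_const_mul' _ _ ENNReal.ofReal_ne_top]
    exact ENNReal.mul_lt_top ENNReal.ofReal_lt_top hm.lintegral_variation_lt_top

lemma measurable_integral_family (hm : IsIntegrableFamily T m) {f : Ioo (0 : ℝ) T × X → ℝ}
    (hf : Measurable f) {C : ℝ} (hC : ∀ p, ‖f p‖ ≤ C) :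
    Measurable (fun t : Ioo (0 : ℝ) T => ∫ᵛ x, f (t, x) ∂•(m t)) :=
  (measurable_integral_and_integral_timeIntegral hm hf hC).1

lemma integrable_integral_family (hm : IsIntegrableFamily T m) {f : Ioo (0 : ℝ) T × X → ℝ}
    (hf : Measurable f) {C : ℝ} (hC : ∀ p, ‖f p‖ ≤ C) :
    Integrable (fun t : Ioo (0 : ℝ) T => ∫ᵛ x, f (t, x) ∂•(m t)) (timeMeasure T) :=
  hm.integrable_of_measurable (measurable_integral_family hm hf hC) fun t x => hC (t, x)

/-- Fubini's theorem for `m_t(dx) dt`. -/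
theorem integral_timeIntegral (hm : IsIntegrableFamily T m) {f : Ioo (0 : ℝ) T × X → ℝ}
    (hf : Measurable f) {C : ℝ} (hC : ∀ p, ‖f p‖ ≤ C) :
    ∫ᵛ p, f p ∂•(timeIntegral T m)
      = ∫ t : Ioo (0 : ℝ) T, ∫ᵛ x, f (t, x) ∂•(m t) ∂timeMeasure T :=
  (measurable_integral_and_integral_timeIntegral hm hf hC).2

end Family

/-! ### Continuously differentiable functions on the torus -/

section Torus

variable {ψ : UnitAddCircle → ℝ}

lemma continuous_torus_iff {f : UnitAddCircle → ℝ} :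
    Continuous f ↔ Continuous fun s : ℝ => f (s : UnitAddCircle) :=
  isQuotientMap_quotient_mk'.continuous_iff

lemma IsC1.continuous (hψ : IsC1 ψ) : Continuous ψ :=
  continuous_torus_iff.2 (ContDiff.continuous hψ)

lemma torusDeriv_coe (ψ : UnitAddCircle → ℝ) (s : ℝ) :
    torusDeriv ψ (s : UnitAddCircle) = deriv (fun r : ℝ => ψ (r : UnitAddCircle)) s := by
  have h := deriv_comp_const_add (f := fun r : ℝ => ψ (r : UnitAddCircle)) s 0
  rw [add_zero] at h
  rw [← h, torusDeriv]
  simp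

lemma IsC1.continuous_torusDeriv (hψ : IsC1 ψ) : Continuous (torusDeriv ψ) := by
  rw [continuous_torus_iff]
  simp_rw [torusDeriv_coe]
  exact hψ.continuous_deriv le_rfl

lemma exists_norm_le {f : UnitAddCircle → ℝ} (hf : Continuous f) : ∃ C, ∀ x, ‖f x‖ ≤ C :=
  ⟨_, (BoundedContinuousFunction.mkOfCompact ⟨f, hf⟩).norm_coe_le_norm⟩

lemma isC1_const (c : ℝ) : IsC1 fun _ => c := contDiff_const

lemma IsC1.const_mul (hψ : IsC1 ψ) (c : ℝ) : IsC1 fun x => c * ψ x :=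
  contDiff_const.mul hψ

lemma torusDeriv_const_mul (c : ℝ) (ψ : UnitAddCircle → ℝ) (x : UnitAddCircle) :
    torusDeriv (fun x => c * ψ x) x = c * torusDeriv ψ x :=
  deriv_const_mul_field c

/-- The `C¹` functions form a subalgebra of the continuous functions. -/
def c1Subalgebra : StarSubalgebra ℝ (BoundedContinuousFunction UnitAddCircle ℝ) where
  carrier := {f | IsC1 f}
  mul_mem' hf hg := ContDiff.mul (𝕜 := ℝ) (n := 1) hf hg
  add_mem' hf hg := ContDiff.add (𝕜 := ℝ) (n := 1) hf hg
  algebraMap_mem' r := isC1_const r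
  star_mem' hf := hf

/-- The character `x ↦ exp(2πix)` is injective on the torus, and its real and imaginary parts are
`C¹`. -/
lemma c1Subalgebra_separates (x y : UnitAddCircle) (hxy : x ≠ y) :
    ∃ f ∈ c1Subalgebra, f x ≠ f y := by
  have hre : IsC1 fun x : UnitAddCircle => (fourier 1 x : ℂ).re := by
    have : (fun s : ℝ => (fourier 1 (s : UnitAddCircle) : ℂ).re)
        = fun s : ℝ => Real.cos (2 * Real.pi * s) := by
      ext s
      rw [fourier_coe_apply, ← Complex.exp_ofReal_mul_I_re]
      congr 2
      push_cast
      ring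
    rw [IsC1, this]
    fun_prop
  have him : IsC1 fun x : UnitAddCircle => (fourier 1 x : ℂ).im := by
    have : (fun s : ℝ => (fourier 1 (s : UnitAddCircle) : ℂ).im)
        = fun s : ℝ => Real.sin (2 * Real.pi * s) := by
      ext s
      rw [fourier_coe_apply, ← Complex.exp_ofReal_mul_I_im]
      congr 2
      push_cast
      ring
    rw [IsC1, this]
    fun_prop
  by_contra! h
  have h1 := h (BoundedContinuousFunction.mkOfCompact ⟨_, hre.continuous⟩) hre
  have h2 := h (BoundedContinuousFunction.mkOfCompact ⟨_, him.continuous⟩) him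
  have h3 : (fourier 1 x : ℂ) = fourier 1 y := Complex.ext h1 h2
  rw [fourier_one, fourier_one] at h3
  exact hxy (AddCircle.injective_toCircle one_ne_zero (Circle.coe_injective h3))

/-- A signed measure on the torus that vanishes on `C¹` functions is zero. -/
lemma signedMeasure_eq_zero_of_c1 {ν : SignedMeasure UnitAddCircle}
    (h : ∀ ψ, IsC1 ψ → ∫ᵛ x, ψ x ∂•ν = 0) : ν = 0 :=
  signedMeasure_ext_of_subalgebra c1Subalgebra c1Subalgebra_separates fun f hf => by
    rw [h f hf, VectorMeasure.integral_zero_vectorMeasure]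

/-- The periodic primitive of a mean-zero continuous function, with a bound for nonnegative
functions minus their mean. -/
lemma exists_primitive {h : UnitAddCircle → ℝ} (hc : Continuous h) (h0 : ∀ x, 0 ≤ h x) :
    ∃ ψ, IsC1 ψ ∧ (∀ x, torusDeriv ψ x = h x - ∫ y, h y) ∧ ∀ x, ‖ψ x‖ ≤ ∫ y, h y := by
  set m := ∫ y, h y with hm
  have hl : Continuous fun s : ℝ => h (s : UnitAddCircle) := continuous_torus_iff.1 hc
  have hl' : Continuous fun s : ℝ => h (s : UnitAddCircle) - m := hl.sub continuous_const
  have hi : ∀ a b, IntervalIntegrable (fun s : ℝ => h (s : UnitAddCircle)) volume a b :=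
    fun a b => hl.intervalIntegrable a b
  have hi' : ∀ a b, IntervalIntegrable (fun s : ℝ => h (s : UnitAddCircle) - m) volume a b :=
    fun a b => hl'.intervalIntegrable a b
  set H : ℝ → ℝ := fun x => ∫ s in (0 : ℝ)..x, (h (s : UnitAddCircle) - m) with hH
  have hHsub : ∀ x, H x = (∫ s in (0 : ℝ)..x, h (s : UnitAddCircle)) - x * m := fun x => by
    rw [hH]
    simp only
    rw [intervalIntegral.integral_sub (hi _ _) intervalIntegrable_const]
    simp
  -- Subtracting the mean `m` makes the integral over one period vanish, so the primitive descends
  -- to the torus.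
  have hper : Function.Periodic H 1 := fun x => by
    rw [hHsub, hHsub, ← intervalIntegral.integral_add_adjacent_intervals (hi 0 x) (hi x (x + 1)),
      UnitAddCircle.intervalIntegral_preimage x h]
    ring
  have hder : ∀ x, HasDerivAt H (h ((x : ℝ) : UnitAddCircle) - m) x := fun x =>
    intervalIntegral.integral_hasDerivAt_right (hi' _ _) (hl'.stronglyMeasurableAtFilter _ _)
      hl'.continuousAt
  refine ⟨hper.lift, ?_, ?_, ?_⟩
  · have : (fun s : ℝ => hper.lift (s : UnitAddCircle)) = H := by
      ext s
      exact hper.lift_coe s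
    rw [IsC1, this, contDiff_one_iff_deriv]
    refine ⟨fun x => (hder x).differentiableAt, ?_⟩
    have : deriv H = fun s : ℝ => h (s : UnitAddCircle) - m := by
      ext x
      exact (hder x).deriv
    rwa [this]
  · intro x
    induction x using QuotientAddGroup.induction_on with
    | H s =>
      rw [torusDeriv_coe]
      have : (fun s : ℝ => hper.lift (s : UnitAddCircle)) = H := by
        ext s
        exact hper.lift_coe s
      rw [this]
      exact (hder s).deriv
  · intro x
    -- For a representative `s ∈ [0,1)`, both `∫₀ˢ h` and `s m` lie in `[0,m]` because `h ≥ 0`;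
    -- their difference is thus at most `m` in absolute value.
    obtain ⟨s, hs, rfl⟩ : ∃ s ∈ Ico (0 : ℝ) (0 + 1), (s : UnitAddCircle) = x := by
      have := AddCircle.coe_image_Ico_eq (1 : ℝ) 0
      have hx : x ∈ ((↑) : ℝ → UnitAddCircle) '' Ico (0 : ℝ) (0 + 1) := by
        rw [this]; trivial
      exact hx
    rw [zero_add] at hs
    have hval : hper.lift (s : UnitAddCircle) = H s := hper.lift_coe s
    rw [hval, hHsub, Real.norm_eq_abs]
    have hm' : ∫ s in (0 : ℝ)..1, h (s : UnitAddCircle) = m := by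
      simpa using UnitAddCircle.intervalIntegral_preimage 0 h
    have hsplit := intervalIntegral.integral_add_adjacent_intervals (hi 0 s) (hi s 1)
    have ha : 0 ≤ ∫ s in (0 : ℝ)..s, h (s : UnitAddCircle) :=
      intervalIntegral.integral_nonneg hs.1 fun _ _ => h0 _
    have hb : 0 ≤ ∫ s in s..1, h (s : UnitAddCircle) :=
      intervalIntegral.integral_nonneg hs.2.le fun _ _ => h0 _
    have hm0 : 0 ≤ m := integral_nonneg h0
    rw [abs_le]
    constructor <;> nlinarith [hs.1, hs.2]

/-- If the distributional derivative of a probability measure on the torus is a finite signed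
measure, then the probability measure is absolutely continuous. -/
theorem absolutelyContinuous_of_deriv (ρ : ProbabilityMeasure UnitAddCircle)
    (ν : SignedMeasure UnitAddCircle)
    (h : ∀ ψ, IsC1 ψ → ∫ x, torusDeriv ψ x ∂(ρ : Measure UnitAddCircle) = ∫ᵛ x, ψ x ∂•ν) :
    (ρ : Measure UnitAddCircle) ≪ volume := by
  -- The `1` accounts for the mean subtracted from `f`; the variation of `ν` multiplies the bound `∫
  -- f` on the primitive.
  set K := 1 + (VectorMeasure.variation ν).real univ with hK
  have hK0 : 0 ≤ K := by positivity
  have hcont : ∀ f : UnitAddCircle → ℝ, Continuous f → (∀ x, 0 ≤ f x) →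
      ∫ x, f x ∂(ρ : Measure UnitAddCircle) ≤ K * ∫ x, f x := by
    intro f hf hf0
    obtain ⟨ψ, hψ, hd, hb⟩ := exists_primitive hf hf0
    have h1 := h ψ hψ
    obtain ⟨C, hC⟩ := exists_norm_le hf
    simp_rw [hd] at h1
    rw [integral_sub (integrable_of_bounded hf.measurable hC) (integrable_const _)] at h1
    have h2 := (Real.le_norm_self _).trans (norm_integral_signed_le ν hb)
    rw [← h1] at h2
    simp only [integral_const, probReal_univ, one_smul] at h2
    rw [hK]
    linarith
  -- The comparison passes to closed sets by letting continuous thickened indicators decrease to the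
  -- indicator; inner regularity then reaches all Borel null sets.
  have hclosed : ∀ F : Set UnitAddCircle, IsClosed F →
      (ρ : Measure UnitAddCircle) F ≤ ENNReal.ofReal K * volume F := by
    intro F hF
    have hpos : ∀ n : ℕ, (0 : ℝ) < 1 / ((n : ℝ) + 1) := fun n => by positivity
    have hlim := tendsto_one_div_add_atTop_nhds_zero_nat (𝕜 := ℝ)
    refine le_of_tendsto_of_tendsto'
      (tendsto_lintegral_thickenedIndicator_of_isClosed (ρ : Measure UnitAddCircle) hF hpos hlim)
      (ENNReal.Tendsto.const_mul
        (tendsto_lintegral_thickenedIndicator_of_isClosed volume hF hpos hlim)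
        (Or.inr ENNReal.ofReal_ne_top)) fun n => ?_
    have hcn := (thickenedIndicator (hpos n) F).continuous
    have hcr : Continuous fun x => (thickenedIndicator (hpos n) F x : ℝ) :=
      NNReal.continuous_coe.comp hcn
    obtain ⟨C, hC⟩ := exists_norm_le hcr
    have := hcont _ hcr fun x => NNReal.coe_nonneg _
    have e : ∀ μ : Measure UnitAddCircle, IsFiniteMeasure μ →
        ∫⁻ x, (thickenedIndicator (hpos n) F x : ℝ≥0∞) ∂μ
          = ENNReal.ofReal (∫ x, (thickenedIndicator (hpos n) F x : ℝ) ∂μ) := by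
      intro μ hμ
      rw [ofReal_integral_eq_lintegral_ofReal (integrable_of_bounded hcr.measurable hC)
        (Eventually.of_forall fun x => NNReal.coe_nonneg _)]
      simp
    rw [e _ inferInstance, e _ inferInstance, ← ENNReal.ofReal_mul hK0]
    exact ENNReal.ofReal_le_ofReal this
  refine Measure.AbsolutelyContinuous.mk fun s hs h0 => ?_
  by_contra hne
  obtain ⟨F, hFs, hF, hlt⟩ := hs.exists_lt_isClosed_of_ne_top (measure_ne_top _ s)
    (pos_iff_ne_zero.2 hne)
  have := hclosed F hF
  rw [measure_mono_null hFs h0, mul_zero] at this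
  exact absurd hlt (not_lt.2 this)

lemma integral_lebDensity {ρ : ProbabilityMeasure UnitAddCircle}
    (hρ : (ρ : Measure UnitAddCircle) ≪ volume) (f : UnitAddCircle → ℝ) :
    ∫ x, f x * lebDensity ρ x = ∫ x, f x ∂(ρ : Measure UnitAddCircle) := by
  rw [← integral_rnDeriv_smul hρ]
  simp_rw [smul_eq_mul, mul_comm, lebDensity]

lemma integrable_lebDensity (ρ : ProbabilityMeasure UnitAddCircle) :
    Integrable (lebDensity ρ) :=
  Measure.integrable_toReal_rnDeriv

lemma continuous_integral_signed (ν : SignedMeasure UnitAddCircle) :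
    Continuous fun f : C(UnitAddCircle, ℝ) => ∫ᵛ x, f x ∂•ν := by
  refine (LipschitzWith.of_dist_le_mul (K := ⟨(VectorMeasure.variation ν).real univ,
    measureReal_nonneg⟩) fun f g => ?_).continuous
  have hf : ∀ f : C(UnitAddCircle, ℝ), VectorMeasure.Integrable ν f := fun f => by
    obtain ⟨C, hC⟩ := exists_norm_le f.continuous
    exact integrable_of_bounded f.continuous.measurable hC
  rw [dist_eq_norm, ← VectorMeasure.integral_fun_sub (hf f) (hf g), mul_comm]
  exact norm_integral_signed_le ν fun x => by
    rw [← dist_eq_norm]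
    exact ContinuousMap.dist_apply_le_dist x

/-- `C¹(𝕋)` is separable, so that a linear identity involving `ψ` and `∂ₓψ` has only to be tested
on countably many functions. -/
lemma exists_countable_c1 : ∃ D : Set (UnitAddCircle → ℝ), D.Countable ∧ (∀ ψ ∈ D, IsC1 ψ) ∧
    ∀ (μ ν : SignedMeasure UnitAddCircle),
      (∀ ψ ∈ D, ∫ᵛ x, torusDeriv ψ x ∂•μ = ∫ᵛ x, ψ x ∂•ν) →
      ∀ ψ, IsC1 ψ → ∫ᵛ x, torusDeriv ψ x ∂•μ = ∫ᵛ x, ψ x ∂•ν := by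
  -- The map `ψ ↦ (ψ, ∂ₓψ)` places `C¹` inside a separable metric space, so its image has a
  -- countable dense subset for the `C¹` norm. Both sides of the identity are continuous in the
  -- pair.
  let S : Set (C(UnitAddCircle, ℝ) × C(UnitAddCircle, ℝ)) :=
    {p | IsC1 p.1 ∧ ∀ x, torusDeriv p.1 x = p.2 x}
  obtain ⟨D, hDS, hDc, hD⟩ :=
    (TopologicalSpace.IsSeparable.of_separableSpace S).exists_countable_dense_subset
  refine ⟨(fun p => (p.1 : UnitAddCircle → ℝ)) '' D, hDc.image _, ?_, fun μ ν h ψ hψ => ?_⟩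
  · rintro _ ⟨p, hp, rfl⟩
    exact (hDS hp).1
  · have hcl : IsClosed {p : C(UnitAddCircle, ℝ) × C(UnitAddCircle, ℝ) |
        ∫ᵛ x, p.2 x ∂•μ = ∫ᵛ x, p.1 x ∂•ν} :=
      isClosed_eq ((continuous_integral_signed μ).comp continuous_snd)
        ((continuous_integral_signed ν).comp continuous_fst)
    have hsub : D ⊆ {p : C(UnitAddCircle, ℝ) × C(UnitAddCircle, ℝ) |
        ∫ᵛ x, p.2 x ∂•μ = ∫ᵛ x, p.1 x ∂•ν} := by
      intro p hp
      have := h p.1 ⟨p, hp, rfl⟩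
      simp_rw [(hDS hp).2] at this
      exact this
    let p : C(UnitAddCircle, ℝ) × C(UnitAddCircle, ℝ) :=
      (⟨ψ, hψ.continuous⟩, ⟨torusDeriv ψ, hψ.continuous_torusDeriv⟩)
    have hp : p ∈ S := ⟨hψ, fun x => rfl⟩
    have hp' : p ∈ closure D := hD hp
    have hp'' := closure_minimal hsub hcl hp'
    rw [mem_ofPred_eq] at hp''
    exact hp''

end Torus

/-! ### Signed measures on `(0,T) × X` with a density in time -/

section Density

variable {X : Type*} [MeasurableSpace X] {T : ℝ}

lemma posPart_add_negPart (ν : SignedMeasure X) :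
    ν.toJordanDecomposition.posPart + ν.toJordanDecomposition.negPart
      = VectorMeasure.variation ν := by
  rw [← SignedMeasure.totalVariation_eq_variation]
  rfl

/-- If `ν(A × B) = 0` for all null sets `A` then the time marginal of `|ν|` is absolutely
continuous. -/
lemma variation_prod_univ_eq_zero {S : Type*} [MeasurableSpace S] {τ : Measure S}
    {ν : SignedMeasure (S × X)}
    (h : ∀ (A : Set S) (B : Set X), MeasurableSet A → MeasurableSet B → τ A = 0 → ν (A ×ˢ B) = 0)
    {A : Set S} (hA : MeasurableSet A) (h0 : τ A = 0) :
    VectorMeasure.variation ν (A ×ˢ univ) = 0 := by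
  have hAu : MeasurableSet (A ×ˢ (univ : Set X)) := hA.prod MeasurableSet.univ
  have hr : ν.restrict (A ×ˢ univ) = 0 := by
    refine VectorMeasure.ext_of_generateFrom _ ?_ generateFrom_prod.symm isPiSystem_prod ?_
    · rintro _ ⟨A', hA', B', hB', rfl⟩
      rw [VectorMeasure.restrict_apply _ hAu (hA'.prod hB'), prod_inter_prod, inter_univ]
      exact h _ _ (hA'.inter hA) hB' (measure_mono_null inter_subset_right h0)
    · rw [VectorMeasure.restrict_apply _ hAu MeasurableSet.univ, univ_inter]
      exact h _ _ hA MeasurableSet.univ h0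
  rw [VectorMeasure.variation_apply_eq_zero hAu]
  intro t ht htm
  have : ν.restrict (A ×ˢ univ) t = 0 := by rw [hr]; rfl
  rwa [VectorMeasure.restrict_apply _ hAu htm, inter_eq_left.2 ht] at this

section Disintegration

variable [StandardBorelSpace X] [Nonempty X]

/-- The disintegration `P_t(dx)` of a finite measure `P(dt dx)` on `(0,T) × X` with respect to
Lebesgue measure in time. -/
def timeSection (P : Measure (Ioo (0 : ℝ) T × X)) [IsFiniteMeasure P] (t : Ioo (0 : ℝ) T) :
    SignedMeasure X :=
  (P.fst.rnDeriv (timeMeasure T) t).toReal • (P.condKernel t).toSignedMeasure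

lemma timeSection_apply (P : Measure (Ioo (0 : ℝ) T × X)) [IsFiniteMeasure P]
    (t : Ioo (0 : ℝ) T) {B : Set X} (hB : MeasurableSet B) :
    timeSection P t B
      = (P.fst.rnDeriv (timeMeasure T) t).toReal * (P.condKernel t).real B := by
  simp [timeSection, Measure.toSignedMeasure_apply_measurable hB]

/-- Absolute continuity of the time marginal lets its Radon–Nikodym derivative convert `dt` back
into that marginal; the rest is the disintegration formula. -/
lemma integral_timeSection (P : Measure (Ioo (0 : ℝ) T × X)) [IsFiniteMeasure P]
    (hP : P.fst ≪ timeMeasure T) {B : Set (Ioo (0 : ℝ) T × X)} (hB : MeasurableSet B) :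
    Integrable (fun t => timeSection P t (Prod.mk t ⁻¹' B)) (timeMeasure T) ∧
      ∫ t, timeSection P t (Prod.mk t ⁻¹' B) ∂timeMeasure T = P.real B := by
  have hm : Measurable fun t => P.condKernel t (Prod.mk t ⁻¹' B) :=
    ProbabilityTheory.Kernel.measurable_kernel_prodMk_left hB
  simp_rw [timeSection_apply P _ (measurable_prodMk_left hB)]
  constructor
  · refine Measure.integrable_toReal_rnDeriv.mul_bdd (c := 1)
      hm.ennreal_toReal.aestronglyMeasurable (Eventually.of_forall fun t => ?_)
    rw [Real.norm_eq_abs, abs_of_nonneg measureReal_nonneg]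
    exact measureReal_le_one
  · simp_rw [← smul_eq_mul]
    rw [integral_rnDeriv_smul hP]
    simp only [Measure.real]
    rw [integral_toReal hm.aemeasurable (Eventually.of_forall fun t => measure_lt_top _ _)]
    congr 1
    exact Measure.lintegral_condKernel_mem hB

lemma variation_timeSection_univ (P : Measure (Ioo (0 : ℝ) T × X)) [IsFiniteMeasure P]
    (t : Ioo (0 : ℝ) T) :
    VectorMeasure.variation (timeSection P t) univ
      = ENNReal.ofReal (P.fst.rnDeriv (timeMeasure T) t).toReal := by
  rw [timeSection, VectorMeasure.variation_smul, Measure.variation_toSignedMeasure,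
    Measure.smul_apply, measure_univ]
  rw [ENNReal.smul_def, smul_eq_mul, mul_one, ← enorm_eq_nnnorm,
    Real.enorm_of_nonneg ENNReal.toReal_nonneg]

open Classical in
/-- A signed measure on `(0,T) × X` that does not charge `A × X` for null sets `A` has a density
in time. -/
theorem exists_timeIntegral_eq {ν : SignedMeasure (Ioo (0 : ℝ) T × X)}
    (h : ∀ (A : Set (Ioo (0 : ℝ) T)) (B : Set X), MeasurableSet A → MeasurableSet B →
      timeMeasure T A = 0 → ν (A ×ˢ B) = 0) :
    ∃ J : ℝ → SignedMeasure X, IsIntegrableFamily T J ∧ ν = timeIntegral T J := by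
  set P := ν.toJordanDecomposition.posPart with hPdef
  set N := ν.toJordanDecomposition.negPart with hNdef
  -- The positive and negative parts could cancel in `ν`, so the hypothesis is first transferred to
  -- the variation, which dominates both.
  have hPN : ∀ A : Set (Ioo (0 : ℝ) T), MeasurableSet A → timeMeasure T A = 0 →
      P (A ×ˢ univ) = 0 ∧ N (A ×ˢ univ) = 0 := by
    intro A hA h0
    have := variation_prod_univ_eq_zero h hA h0
    rw [← posPart_add_negPart, Measure.add_apply] at this
    exact add_eq_zero.1 this
  have hac : ∀ Q : Measure (Ioo (0 : ℝ) T × X), (∀ A : Set (Ioo (0 : ℝ) T), MeasurableSet A →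
      timeMeasure T A = 0 → Q (A ×ˢ univ) = 0) → Q.fst ≪ timeMeasure T := by
    intro Q hQ
    refine Measure.AbsolutelyContinuous.mk fun A hA h0 => ?_
    rw [Measure.fst_apply hA, ← prod_univ]
    exact hQ A hA h0
  have hP : P.fst ≪ timeMeasure T := hac P fun A hA h0 => (hPN A hA h0).1
  have hN : N.fst ≪ timeMeasure T := hac N fun A hA h0 => (hPN A hA h0).2
  let J : ℝ → SignedMeasure X := fun t =>
    if ht : t ∈ Ioo (0 : ℝ) T then timeSection P ⟨t, ht⟩ - timeSection N ⟨t, ht⟩ else 0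
  have hJ : ∀ t : Ioo (0 : ℝ) T, J t = timeSection P t - timeSection N t := fun t =>
    dif_pos t.2
  have hint : IsIntegrableFamily T J := by
    constructor
    · intro B hB
      simp_rw [hJ, sub_apply, timeSection_apply _ _ hB]
      exact ((Measure.measurable_rnDeriv _ _).ennreal_toReal.mul
        (P.condKernel.measurable_coe hB).ennreal_toReal).sub
        ((Measure.measurable_rnDeriv _ _).ennreal_toReal.mul
        (N.condKernel.measurable_coe hB).ennreal_toReal)
    · rw [← lintegral_subtype_comap measurableSet_Ioo fun t => (J t).variation univ]
      simp_rw [hJ]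
      refine (lintegral_mono (g := fun t =>
        ENNReal.ofReal (P.fst.rnDeriv (timeMeasure T) t).toReal
          + ENNReal.ofReal (N.fst.rnDeriv (timeMeasure T) t).toReal) fun t => ?_).trans_lt
        (b := ∫⁻ t, (ENNReal.ofReal (P.fst.rnDeriv (timeMeasure T) t).toReal
          + ENNReal.ofReal (N.fst.rnDeriv (timeMeasure T) t).toReal) ∂timeMeasure T) ?_
      · beta_reduce
        rw [← variation_timeSection_univ, ← variation_timeSection_univ, ← Measure.add_apply]
        exact VectorMeasure.variation_sub_le univ
      · rw [lintegral_add_left (Measure.measurable_rnDeriv _ _).ennreal_toReal.ennreal_ofReal]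
        refine ENNReal.add_lt_top.2 ⟨?_, ?_⟩
        · exact Measure.integrable_toReal_rnDeriv.lintegral_lt_top
        · exact Measure.integrable_toReal_rnDeriv.lintegral_lt_top
  refine ⟨J, hint, ?_⟩
  ext B hB
  rw [timeIntegral_apply hint hB]
  simp_rw [hJ, sub_apply]
  rw [integral_sub (integral_timeSection P hP hB).1 (integral_timeSection N hN hB).1,
    (integral_timeSection P hP hB).2, (integral_timeSection N hN hB).2,
    SignedMeasure.apply_eq_posPart_real_sub_negPart_real ν hB]

end Disintegration

end Density

/-! ### Identification of a measure through `C¹` test functions -/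

section Test

variable {T : ℝ}

/-- Restrictions of `C¹` functions to `(0,T)`. -/
def c1TimeSubalgebra (T : ℝ) : StarSubalgebra ℝ (BoundedContinuousFunction (Ioo (0 : ℝ) T) ℝ) where
  carrier := {f | ∃ η : ℝ → ℝ, ContDiff ℝ 1 η ∧ ∀ t, f t = η t}
  mul_mem' := fun ⟨η, hη, h⟩ ⟨θ, hθ, h'⟩ => ⟨fun t => η t * θ t, hη.mul hθ, fun t => by
    simp [h, h']⟩
  add_mem' := fun ⟨η, hη, h⟩ ⟨θ, hθ, h'⟩ => ⟨fun t => η t + θ t, hη.add hθ, fun t => by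
    simp [h, h']⟩
  algebraMap_mem' r := ⟨fun _ => r, contDiff_const, fun _ => rfl⟩
  star_mem' := fun ⟨η, hη, h⟩ => ⟨η, hη, fun t => by simp [h]⟩

lemma exists_bound_of_continuous (T : ℝ) {η : ℝ → ℝ} (hη : Continuous η) :
    ∃ C, ∀ t ∈ Icc 0 T, ‖η t‖ ≤ C :=
  isCompact_Icc.exists_bound_of_continuousOn hη.continuousOn

lemma c1TimeSubalgebra_separates (x y : Ioo (0 : ℝ) T) (hxy : x ≠ y) :
    ∃ f ∈ c1TimeSubalgebra T, f x ≠ f y := by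
  refine ⟨BoundedContinuousFunction.ofNormedAddCommGroup (fun t : Ioo (0 : ℝ) T => (t : ℝ))
    continuous_subtype_val T fun t => ?_, ⟨id, contDiff_id, fun t => rfl⟩, ?_⟩
  · rw [Real.norm_eq_abs, abs_of_pos t.2.1]
    exact t.2.2.le
  · exact fun h => hxy (Subtype.ext h)

instance polishSpace_Ioo (T : ℝ) : PolishSpace (Ioo (0 : ℝ) T) := isOpen_Ioo.polishSpace

/-- If `∫ η(t) ψ(x) dν = ∫ η(t) g(t) dt` for all `C¹` functions `η` then the same holds for
indicators `η` of measurable sets. -/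
theorem integral_indicator_mul_eq {X : Type*} [MeasurableSpace X]
    {ν : SignedMeasure (Ioo (0 : ℝ) T × X)} {ψ : X → ℝ}
    (hψ : Measurable ψ) {C : ℝ} (hC : ∀ x, ‖ψ x‖ ≤ C) {g : Ioo (0 : ℝ) T → ℝ}
    (hg : Integrable g (timeMeasure T))
    (h : ∀ η : ℝ → ℝ, ContDiff ℝ 1 η →
      ∫ᵛ p, η p.1 * ψ p.2 ∂•ν = ∫ t, η t * g t ∂timeMeasure T)
    {A : Set (Ioo (0 : ℝ) T)} (hA : MeasurableSet A) :
    ∫ᵛ p in A ×ˢ univ, ψ p.2 ∂•ν = ∫ t in A, g t ∂timeMeasure T := by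
  have hψm : Measurable fun p : Ioo (0 : ℝ) T × X => ψ p.2 := hψ.comp measurable_snd
  have hψi : VectorMeasure.Integrable ν fun p : Ioo (0 : ℝ) T × X => ψ p.2 :=
    integrable_of_bounded hψm fun p => hC _
  -- Absorbing `ψ` into the measure reduces the claim to identifying the time marginal of `ψ ν` with
  -- `g dt`, which test functions of time alone can decide.
  let μ : SignedMeasure (Ioo (0 : ℝ) T × X) :=
    ν.withDensity (fun p => ψ p.2) (ContinuousLinearMap.lsmul ℝ ℝ)
  have hμ : ∀ f : Ioo (0 : ℝ) T × X → ℝ, Measurable f → ∀ D : ℝ, (∀ p, ‖f p‖ ≤ D) →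
      ∫ᵛ p, f p ∂•μ = ∫ᵛ p, f p * ψ p.2 ∂•ν := by
    intro f hf D hD
    refine bounded_measurable_induction
      (P := fun f => ∫ᵛ p, f p ∂•μ = ∫ᵛ p, f p * ψ p.2 ∂•ν) ?_ ?_ ?_ hf hD
    · intro c s hs
      rw [integral_signed_indicator_const _ c hs, VectorMeasure.withDensity_apply hψi,
        ← VectorMeasure.integral_indicator hs, ← smul_eq_mul, ← VectorMeasure.integral_fun_smul]
      congr with p
      by_cases hp : p ∈ s <;> simp [hp]
    · intro f₁ f₂ C₁ C₂ hf₁ hf₂ hC₁ hC₂ h₁ h₂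
      rw [VectorMeasure.integral_fun_add (integrable_of_bounded hf₁ hC₁)
        (integrable_of_bounded hf₂ hC₂), h₁, h₂, ← VectorMeasure.integral_fun_add]
      · simp_rw [add_mul]
      · exact Integrable.bdd_mul (f := f₁) hψi hf₁.aestronglyMeasurable (Eventually.of_forall hC₁)
      · exact Integrable.bdd_mul (f := f₂) hψi hf₂.aestronglyMeasurable (Eventually.of_forall hC₂)
    · intro F f D hF hf hD hlim hP
      refine tendsto_nhds_unique (tendsto_integral_signed μ hF hD hlim) ?_
      simp_rw [hP]
      refine tendsto_integral_signed (C := D * C) ν (fun n => (hF n).mul hψm) (fun n p => ?_)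
        fun p => (hlim p).mul_const _
      rw [norm_mul]
      exact mul_le_mul (hD n p) (hC _) (norm_nonneg _) ((norm_nonneg _).trans (hD n p))
  have key : μ.map Prod.fst = (timeMeasure T).withDensityᵥ g := by
    refine signedMeasure_ext_of_subalgebra (c1TimeSubalgebra T) c1TimeSubalgebra_separates
      fun f hf => ?_
    obtain ⟨η, hη, hfη⟩ := hf
    have hfm : Measurable f := f.continuous.measurable
    have hfb := f.norm_coe_le_norm
    rw [VectorMeasure.integral_map measurable_fst hfm.aestronglyMeasurable
      (integrable_of_bounded (hfm.comp measurable_fst) fun p => hfb _),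
      hμ (fun p => f p.1) (hfm.comp measurable_fst) _ fun p => hfb _,
      integral_signed_of_density hg (fun s hs => withDensityᵥ_apply hg hs) hfm hfb]
    simp_rw [hfη]
    exact h η hη
  have h1 := congrArg (fun m : SignedMeasure (Ioo (0 : ℝ) T) => m A) key
  rw [VectorMeasure.map_apply _ measurable_fst hA, withDensityᵥ_apply hg hA,
    VectorMeasure.withDensity_apply hψi, ← prod_univ] at h1
  exact h1

end Test

/-! ### The continuity equation tested with `v ψ(x)` -/

lemma Vel.mul_self (v : Vel) : (v : ℝ) * v = 1 := by
  obtain ⟨v, hv | hv⟩ := v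
  · simp [hv]
  · have : v = 1 := hv
    simp [this]

lemma Vel.abs_eq_one (v : Vel) : |(v : ℝ)| = 1 := by
  obtain ⟨v, hv | hv⟩ := v
  · simp [hv]
  · have : v = 1 := hv
    simp [this]

section Equation

variable {ψ : UnitAddCircle → ℝ}

lemma measurable_vel_mul (hψ : Continuous ψ) :
    Measurable fun p : Omega => (p.2 : ℝ) * ψ p.1 :=
  (measurable_subtype_coe.comp measurable_snd).mul (hψ.measurable.comp measurable_fst)

lemma norm_vel_mul_le {C : ℝ} (hC : ∀ x, ‖ψ x‖ ≤ C) (p : Omega) : ‖(p.2 : ℝ) * ψ p.1‖ ≤ C := by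
  rw [norm_mul, Real.norm_eq_abs, Vel.abs_eq_one, one_mul]
  exact hC _

lemma integral_slice (m : SignedMeasure Omega) (v : Vel) (hψ : Continuous ψ) :
    ∫ᵛ x, ψ x ∂•(slice m v)
      = ∫ᵛ p, ((univ : Set UnitAddCircle) ×ˢ ({v} : Set Vel)).indicator (fun p => ψ p.1) p ∂•m := by
  obtain ⟨C, hC⟩ := exists_norm_le hψ
  have hv : MeasurableSet ((univ : Set UnitAddCircle) ×ˢ ({v} : Set Vel)) :=
    MeasurableSet.univ.prod (measurableSet_singleton v)
  rw [slice, VectorMeasure.integral_map measurable_fst hψ.measurable.aestronglyMeasurable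
    (integrable_of_bounded (hψ.measurable.comp measurable_fst) fun p => hC _),
    VectorMeasure.integral_indicator hv]

lemma integral_derivedFlux (V : ℝ) (j : Flux) (hψ : Continuous ψ) :
    ∫ᵛ x, ψ x ∂•(derivedFlux V j) = V⁻¹ * ∫ᵛ p, (p.2 : ℝ) * ψ p.1 ∂•j.2 := by
  obtain ⟨C, hC⟩ := exists_norm_le hψ
  have hv : ∀ v : Vel, MeasurableSet ((univ : Set UnitAddCircle) ×ˢ ({v} : Set Vel)) :=
    fun v => MeasurableSet.univ.prod (measurableSet_singleton v)
  have hi : ∀ v : Vel, VectorMeasure.Integrable j.2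
      (((univ : Set UnitAddCircle) ×ˢ ({v} : Set Vel)).indicator fun p => ψ p.1) := fun v =>
    (integrable_of_bounded (hψ.measurable.comp measurable_fst) fun p => hC _).indicator (hv v)
  -- The test function is split over the velocity slices; the weight `v / V` in the derived flux
  -- then leaves the single factor `V⁻¹`.
  have hsum : ∀ p : Omega, (p.2 : ℝ) * ψ p.1 = ∑ v : Vel, (v : ℝ) •
      ((univ : Set UnitAddCircle) ×ˢ ({v} : Set Vel)).indicator (fun p => ψ p.1) p := by
    intro p
    rw [Finset.sum_eq_single p.2]
    · simp
    · intro v _ hne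
      simp [Ne.symm hne]
    · simp
  rw [derivedFlux, VectorMeasure.integral_finsetSum_vectorMeasure]
  · simp_rw [hsum]
    rw [VectorMeasure.integral_finsetSum, Finset.mul_sum]
    · refine Finset.sum_congr rfl fun v _ => ?_
      rw [VectorMeasure.integral_smul_vectorMeasure, integral_slice _ _ hψ,
        VectorMeasure.integral_fun_smul, smul_eq_mul, smul_eq_mul]
      ring
    · exact fun v _ => (hi v).smul (v : ℝ)
  · exact fun v _ => integrable_of_bounded hψ.measurable hC

lemma variation_slice_le (m : SignedMeasure Omega) (v : Vel) :
    (slice m v).variation univ ≤ m.variation univ := by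
  refine (VectorMeasure.variation_map_le univ).trans ?_
  rw [Measure.map_apply measurable_fst MeasurableSet.univ, preimage_univ]
  refine (VectorMeasure.variation_restrict_le univ).trans ?_
  exact Measure.restrict_le_self univ

lemma variation_sum_le {X ι : Type*} [MeasurableSpace X] (s : Finset ι)
    (m : ι → SignedMeasure X) (B : Set X) :
    (∑ i ∈ s, m i).variation B ≤ ∑ i ∈ s, (m i).variation B := by
  classical
  induction s using Finset.induction_on with
  | empty => simp
  | insert i s hi ih =>
    rw [Finset.sum_insert hi, Finset.sum_insert hi]
    exact (VectorMeasure.variation_add_le B).trans (add_le_add le_rfl ih)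

lemma ContinuityEq.isIntegrableFamily_fst {T : ℝ} {σ : ℝ → ProbabilityMeasure Omega}
    {j : ℝ → Flux} (h : ContinuityEq T σ j) : IsIntegrableFamily T fun t => (j t).1 :=
  ⟨h.measurable_fst, (lintegral_mono fun _ => le_self_add).trans_lt h.integrable⟩

lemma ContinuityEq.isIntegrableFamily_snd {T : ℝ} {σ : ℝ → ProbabilityMeasure Omega}
    {j : ℝ → Flux} (h : ContinuityEq T σ j) : IsIntegrableFamily T fun t => (j t).2 :=
  ⟨h.measurable_snd, (lintegral_mono fun _ => le_add_self).trans_lt h.integrable⟩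

lemma ContinuityEq.isIntegrableFamily_derivedFlux {T : ℝ} {σ : ℝ → ProbabilityMeasure Omega}
    {j : ℝ → Flux} (h : ContinuityEq T σ j) (V : ℝ) :
    IsIntegrableFamily T fun t => derivedFlux V (j t) := by
  have happ : ∀ t, ∀ B : Set UnitAddCircle, MeasurableSet B →
      derivedFlux V (j t) B = ∑ v : Vel, (v : ℝ) / V * (j t).2 (B ×ˢ {v}) := by
    intro t B hB
    rw [derivedFlux, sum_apply]
    simp_rw [smul_apply, slice_apply _ _ hB, smul_eq_mul]
  constructor
  · intro B hB
    simp_rw [happ _ B hB]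
    exact Finset.measurable_sum _ fun v _ =>
      (h.measurable_snd _ (hB.prod (measurableSet_singleton v))).const_mul _
  · have hle : ∀ t, (derivedFlux V (j t)).variation univ
        ≤ (∑ v : Vel, ‖(v : ℝ) / V‖ₑ) * (j t).2.variation univ := by
      intro t
      refine (variation_sum_le _ _ _).trans ?_
      rw [Finset.sum_mul]
      refine Finset.sum_le_sum fun v _ => ?_
      rw [VectorMeasure.variation_smul, Measure.smul_apply, ENNReal.smul_def, smul_eq_mul,
        ← enorm_eq_nnnorm]
      exact mul_le_mul_right (variation_slice_le _ _) _
    refine (lintegral_mono hle).trans_lt ?_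
    have hfin : (∑ v : Vel, ‖(v : ℝ) / V‖ₑ) < ∞ := ENNReal.sum_lt_top.2 fun _ _ => enorm_lt_top
    rw [lintegral_const_mul' _ _ hfin.ne]
    exact ENNReal.mul_lt_top hfin h.isIntegrableFamily_snd.2

/-- The function `v ψ(x)` is odd in `v`, so a velocity flip changes it by `-2 v ψ(x)`; this is the
origin of the factor 2 in the limit equation. -/
lemma gradPairing_vel_mul (j : Flux) (ψ : UnitAddCircle → ℝ) :
    gradPairing (fun p => (p.2 : ℝ) * ψ p.1) j
      = (∫ᵛ p, (p.2 : ℝ) * torusDeriv ψ p.1 ∂•j.1)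
        - 2 * ∫ᵛ p, (p.2 : ℝ) * ψ p.1 ∂•j.2 := by
  rw [gradPairing, sub_eq_add_neg]
  congr 1
  · simp_rw [torusDeriv_const_mul]
  · rw [← neg_mul, ← smul_eq_mul, ← VectorMeasure.integral_fun_smul]
    congr with p
    simp only [Vel.rev, smul_eq_mul]
    ring

/-- The velocity in the test function cancels the velocity in `V v σ` since `v² = 1`, leaving only
the spatial density. -/
lemma integral_vel_mul_withDensity (V : ℝ) (σ : ProbabilityMeasure Omega)
    (hψ : Continuous ψ) :
    ∫ᵛ p, (p.2 : ℝ) * ψ p.1 ∂•((σ : Measure Omega).withDensityᵥ fun p => V * (p.2 : ℝ))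
      = V * ∫ x, ψ x ∂(density σ : Measure UnitAddCircle) := by
  obtain ⟨C, hC⟩ := exists_norm_le hψ
  have hg : Integrable (fun p : Omega => V * (p.2 : ℝ)) (σ : Measure Omega) :=
    integrable_of_bounded ((measurable_subtype_coe.comp measurable_snd).const_mul V)
      (C := |V|) fun p => by
        rw [norm_mul, Real.norm_eq_abs, Real.norm_eq_abs, Vel.abs_eq_one, mul_one]
  rw [integral_signed_of_density hg (fun s hs => withDensityᵥ_apply hg hs)
    (measurable_vel_mul hψ) (norm_vel_mul_le hC), density, ProbabilityMeasure.toMeasure_map,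
    integral_map measurable_fst.aemeasurable hψ.measurable.aestronglyMeasurable,
    ← integral_const_mul]
  congr with p
  have := Vel.mul_self p.2
  linear_combination V * ψ p.1 * this

lemma continuousOn_integral {X : Type*} [TopologicalSpace X] [MeasurableSpace X]
    [OpensMeasurableSpace X] {s : Set ℝ} {σ : ℝ → ProbabilityMeasure X} (hσ : ContinuousOn σ s)
    (f : BoundedContinuousFunction X ℝ) :
    ContinuousOn (fun t => ∫ x, f x ∂(σ t : Measure X)) s := fun t ht =>
  ProbabilityMeasure.tendsto_iff_forall_integral_tendsto.1 (hσ t ht) f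

lemma continuousOn_integral_density {T : ℝ} {σ : ℝ → ProbabilityMeasure Omega}
    (hσ : ContinuousOn σ (Icc 0 T)) (hψ : Continuous ψ) :
    ContinuousOn (fun t => ∫ x, ψ x ∂(density (σ t) : Measure UnitAddCircle)) (Icc 0 T) := by
  obtain ⟨C, hC⟩ := exists_norm_le hψ
  have h := continuousOn_integral hσ (BoundedContinuousFunction.ofNormedAddCommGroup
    (fun p : Omega => ψ p.1) (hψ.comp continuous_fst) C fun p => hC _)
  refine h.congr fun t _ => ?_
  simp only
  rw [density, ProbabilityMeasure.toMeasure_map,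
    integral_map measurable_fst.aemeasurable hψ.measurable.aestronglyMeasurable]
  rfl

lemma measurable_Ioo_of_continuousOn {T : ℝ} {f : ℝ → ℝ} (hf : ContinuousOn f (Icc 0 T)) :
    Measurable fun t : Ioo (0 : ℝ) T => f t :=
  (continuousOn_iff_continuous_domRestrict.1 (hf.mono Ioo_subset_Icc_self)).measurable

/-- For almost every time, finiteness of the rate functional identifies `j¹`. -/
lemma ae_gradPairing_eq {α T V : ℝ} (hV : 0 < V) {σ : ℝ → ProbabilityMeasure Omega}
    {j : ℝ → Flux} (h : ContinuityEq T σ j) (hfin : rateFunctional α T V σ j < ∞)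
    (hψ : IsC1 ψ) :
    ∀ᵐ t : Ioo (0 : ℝ) T ∂timeMeasure T, gradPairing (fun p => (p.2 : ℝ) * ψ p.1) (j t)
      = V * ((∫ x, torusDeriv ψ x ∂(density (σ t) : Measure UnitAddCircle))
        - 2 * ∫ᵛ x, ψ x ∂•(derivedFlux V (j t))) := by
  rw [rateFunctional, if_pos h,
    ← lintegral_subtype_comap measurableSet_Ioo fun t => lagrangian α V (σ t) (j t)] at hfin
  have hd := hψ.continuous_torusDeriv
  obtain ⟨C, hC⟩ := exists_norm_le hd
  -- Only the scalar consequence of `j¹ = V v σ` for this `ψ` is needed, and it defines a measurable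
  -- set of times. Off this set the Lagrangian is infinite, so positive measure of the complement
  -- would contradict finite action.
  set E : Set (Ioo (0 : ℝ) T) := {t | ∫ᵛ p, (p.2 : ℝ) * torusDeriv ψ p.1 ∂•(j t).1
    = V * ∫ x, torusDeriv ψ x ∂(density (σ t) : Measure UnitAddCircle)} with hE
  have hEm : MeasurableSet E := by
    refine measurableSet_eq_fun ?_
      ((measurable_Ioo_of_continuousOn (continuousOn_integral_density h.continuousOn hd)).const_mul V)
    exact measurable_integral_family h.isIntegrableFamily_fst
      (f := fun q : Ioo (0 : ℝ) T × Omega => (q.2.2 : ℝ) * torusDeriv ψ q.2.1)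
      ((measurable_vel_mul hd).comp measurable_snd) fun q => norm_vel_mul_le hC q.2
  have hnull : timeMeasure T Eᶜ = 0 := by
    by_contra hne
    refine absurd hfin (not_lt.2 ?_)
    calc (∞ : ℝ≥0∞) = ∞ * timeMeasure T Eᶜ := (ENNReal.top_mul hne).symm
      _ = ∫⁻ t, Eᶜ.indicator (fun _ => ∞) t ∂timeMeasure T := by
        rw [lintegral_indicator_const hEm.compl]
      _ ≤ _ := by
        refine lintegral_mono fun t => ?_
        by_cases ht : t ∈ E
        · simp [ht]
        · have : (j t).1 ≠ (σ t : Measure Omega).withDensityᵥ fun p => V * (p.2 : ℝ) := by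
            intro heq
            apply ht
            rw [hE, mem_ofPred_eq, heq, integral_vel_mul_withDensity V _ hd]
          rw [lagrangian, if_neg this]
          exact le_top
  filter_upwards [compl_mem_ae_iff.2 hnull] with t ht
  rw [compl_compl] at ht
  rw [gradPairing_vel_mul, show _ = _ from ht, integral_derivedFlux V _ hψ.continuous]
  field_simp

end Equation

/-! ### Passage to the limit -/

section Limit

variable {T : ℝ} {ψ : UnitAddCircle → ℝ}

/-- Integration by parts against the primitive of an integrable function. -/
lemma abs_integral_mul_le {g η : ℝ → ℝ} (hT : 0 ≤ T) (hg : IntervalIntegrable g volume 0 T)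
    (hη : ContDiff ℝ 1 η) {D : ℝ} (hD : ∀ t ∈ Icc 0 T, |∫ r in (0 : ℝ)..t, g r| ≤ D) :
    |∫ t in (0 : ℝ)..T, η t * g t| ≤ (|η T| + ∫ t in (0 : ℝ)..T, |deriv η t|) * D := by
  set H : ℝ → ℝ := fun t => ∫ r in (0 : ℝ)..t, g r with hH
  have hHac : AbsolutelyContinuousOnInterval H 0 T :=
    hg.absolutelyContinuousOnInterval_intervalIntegral left_mem_uIcc
  have hηac : AbsolutelyContinuousOnInterval η 0 T := hη.contDiffOn.absolutelyContinuousOnInterval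
  have hparts := hηac.integral_mul_deriv_eq_deriv_mul hHac
  -- As `g` is merely integrable, `H` is absolutely continuous with `H' = g` only almost everywhere.
  have hcongr : ∫ t in (0 : ℝ)..T, η t * deriv H t = ∫ t in (0 : ℝ)..T, η t * g t := by
    refine intervalIntegral.integral_congr_ae ?_
    filter_upwards [hg.ae_hasDerivAt_integral] with t ht hmem
    rw [(ht (uIoc_subset_uIcc hmem) 0 left_mem_uIcc).deriv]
  have hH0 : H 0 = 0 := intervalIntegral.integral_same
  rw [← hcongr, hparts, hH0, mul_zero, sub_zero, add_mul]
  have hd : Continuous (deriv η) := hη.continuous_deriv le_rfl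
  have h1 : |η T * H T| ≤ |η T| * D := by
    rw [abs_mul]
    exact mul_le_mul_of_nonneg_left (hD T ⟨hT, le_rfl⟩) (abs_nonneg _)
  have h2 : |∫ t in (0 : ℝ)..T, deriv η t * H t| ≤ (∫ t in (0 : ℝ)..T, |deriv η t|) * D := by
    rw [← intervalIntegral.integral_mul_const]
    refine (intervalIntegral.abs_integral_le_integral_abs hT).trans ?_
    refine intervalIntegral.integral_mono_on hT
      ((hd.continuousOn.mul hHac.continuousOn).abs.intervalIntegrable)
      ((hd.abs.mul continuous_const).intervalIntegrable _ _) fun t ht => ?_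
    rw [abs_mul]
    exact mul_le_mul_of_nonneg_left (hD t ht) (abs_nonneg _)
  exact (abs_sub _ _).trans (add_le_add h1 h2)

/-- The weak form of `∂ₓρ = -2J`, up to an error of order `1/V`. -/
lemma abs_integral_weak_le {α V : ℝ} (hT : 0 < T) (hV : 0 < V) {σ : ℝ → ProbabilityMeasure Omega}
    {j : ℝ → Flux} (h : ContinuityEq T σ j) (hfin : rateFunctional α T V σ j < ∞)
    (hψ : IsC1 ψ) {C : ℝ} (hC : ∀ x, ‖ψ x‖ ≤ C) {η : ℝ → ℝ} (hη : ContDiff ℝ 1 η) :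
    |(∫ t : Ioo (0 : ℝ) T, η t * ∫ x, torusDeriv ψ x ∂(density (σ t) : Measure UnitAddCircle)
        ∂timeMeasure T)
      - 2 * ∫ᵛ p, η p.1 * ψ p.2 ∂•(timeIntegral T fun t => derivedFlux V (j t))|
      ≤ (|η T| + ∫ t in (0 : ℝ)..T, |deriv η t|) * (2 * C) * V⁻¹ := by
  have hd := hψ.continuous_torusDeriv
  obtain ⟨C', hC'⟩ := exists_norm_le hd
  obtain ⟨M, hM⟩ := exists_bound_of_continuous T hη.continuous
  have hM' : ∀ t : Ioo (0 : ℝ) T, ‖η t‖ ≤ M := fun t => hM t (Ioo_subset_Icc_self t.2)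
  have hηm : Measurable fun t : Ioo (0 : ℝ) T => η t :=
    hη.continuous.measurable.comp measurable_subtype_coe
  have hJi := h.isIntegrableFamily_derivedFlux V
  set φ : Omega → ℝ := fun p => (p.2 : ℝ) * ψ p.1 with hφ
  set g : ℝ → ℝ := fun t => gradPairing φ (j t) with hg
  set a : Ioo (0 : ℝ) T → ℝ := fun t =>
    ∫ x, torusDeriv ψ x ∂(density (σ t) : Measure UnitAddCircle) with ha
  set b : Ioo (0 : ℝ) T → ℝ := fun t => ∫ᵛ x, ψ x ∂•(derivedFlux V (j t)) with hb
  have hgi : IntervalIntegrable g volume 0 T := by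
    rw [intervalIntegrable_iff_integrableOn_Ioo_of_le hT.le,
      integrableOn_iff_comap_subtypeVal measurableSet_Ioo]
    have h1 := integrable_integral_family h.isIntegrableFamily_fst
      (f := fun q : Ioo (0 : ℝ) T × Omega => (q.2.2 : ℝ) * torusDeriv ψ q.2.1)
      ((measurable_vel_mul hd).comp measurable_snd) fun q => norm_vel_mul_le hC' q.2
    have h2 := integrable_integral_family h.isIntegrableFamily_snd
      (f := fun q : Ioo (0 : ℝ) T × Omega => (q.2.2 : ℝ) * ψ q.2.1)
      ((measurable_vel_mul hψ.continuous).comp measurable_snd) fun q => norm_vel_mul_le hC q.2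
    refine (h1.sub (h2.const_mul 2)).congr (Eventually.of_forall fun t => ?_)
    exact (gradPairing_vel_mul (j t) ψ).symm
  have hφC1 : IsC10 φ := fun v => hψ.const_mul v
  have hφb : ∀ t, |∫ p, φ p ∂(σ t : Measure Omega)| ≤ C := fun t => by
    have := norm_integral_le_of_norm_le_const (μ := (σ t : Measure Omega))
      (Eventually.of_forall (norm_vel_mul_le hC))
    simpa using this
  -- By the continuity equation the primitive is a difference of two averages of `φ`, each at most
  -- `C`; this bound does not involve `V`.
  have hprim : ∀ t ∈ Icc 0 T, |∫ r in (0 : ℝ)..t, g r| ≤ 2 * C := by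
    intro t ht
    rw [← h.weak φ hφC1 0 t le_rfl ht.1 ht.2]
    exact (abs_sub _ _).trans (by linarith [hφb t, hφb 0])
  have hmain := abs_integral_mul_le hT.le hgi hη hprim
  have hai : Integrable (fun t : Ioo (0 : ℝ) T => η t * a t) (timeMeasure T) := by
    refine integrable_of_bounded (C := M * C') (hηm.mul
      (measurable_Ioo_of_continuousOn (continuousOn_integral_density h.continuousOn hd)))
      fun t => ?_
    have := norm_integral_le_of_norm_le_const (μ := (density (σ t) : Measure UnitAddCircle))
      (Eventually.of_forall hC')
    rw [norm_mul]
    simp only [probReal_univ, mul_one] at this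
    exact mul_le_mul (hM' t) this (norm_nonneg _) ((norm_nonneg _).trans (hM' t))
  have hbi : Integrable (fun t : Ioo (0 : ℝ) T => η t * b t) (timeMeasure T) :=
    (integrable_integral_family hJi (f := fun q : Ioo (0 : ℝ) T × UnitAddCircle => ψ q.2)
      (hψ.continuous.measurable.comp measurable_snd) fun q => hC q.2).bdd_mul
      hηm.aestronglyMeasurable (Eventually.of_forall hM')
  have hFub : ∫ᵛ p, η p.1 * ψ p.2 ∂•(timeIntegral T fun t => derivedFlux V (j t))
      = ∫ t : Ioo (0 : ℝ) T, η t * b t ∂timeMeasure T := by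
    rw [integral_timeIntegral hJi (f := fun p : Ioo (0 : ℝ) T × UnitAddCircle => η p.1 * ψ p.2)
      (C := M * C) ((hηm.comp measurable_fst).mul (hψ.continuous.measurable.comp measurable_snd))]
    · congr with t
      rw [hb, ← smul_eq_mul, ← VectorMeasure.integral_fun_smul]
      rfl
    · intro p
      rw [norm_mul]
      exact mul_le_mul (hM' _) (hC _) (norm_nonneg _) ((norm_nonneg _).trans (hM' p.1))
  -- The whole integrand carries a factor `V`; dividing the uniform bound by it produces the `V⁻¹`
  -- in the error.
  have heq : ∫ t in (0 : ℝ)..T, η t * g t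
      = V * ((∫ t : Ioo (0 : ℝ) T, η t * a t ∂timeMeasure T)
        - 2 * ∫ t : Ioo (0 : ℝ) T, η t * b t ∂timeMeasure T) := by
    rw [intervalIntegral.integral_of_le hT.le, integral_Ioc_eq_integral_Ioo,
      ← integral_timeMeasure fun t => η t * g t, ← integral_const_mul 2,
      ← integral_sub hai (hbi.const_mul 2), ← integral_const_mul]
    refine integral_congr_ae ?_
    filter_upwards [ae_gradPairing_eq hV h hfin hψ] with t ht
    rw [hg]
    simp only
    rw [ht]
    ring
  rw [hFub, ← div_eq_mul_inv, le_div_iff₀ hV]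
  rw [heq, abs_mul, abs_of_pos hV] at hmain
  linarith

/-- The weak form of `∂ₓρ̄ = -2J̄`. -/
theorem integral_limit_eq {α : ℝ} (hT : 0 < T) {V : ℕ → ℝ} (hV : ∀ n, 1 ≤ V n)
    (hVlim : Tendsto V atTop atTop) {σ : ℕ → ℝ → ProbabilityMeasure Omega} {j : ℕ → ℝ → Flux}
    (hCE : ∀ n, ContinuityEq T (σ n) (j n))
    (hfin : ∀ n, rateFunctional α T (V n) (σ n) (j n) < ∞)
    {ρbar : ℝ → ProbabilityMeasure UnitAddCircle}
    {Jbar : SignedMeasure (Ioo (0 : ℝ) T × UnitAddCircle)}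
    (hJ : NarrowTendsto (fun n => timeIntegral T fun t => derivedFlux (V n) (j n t)) Jbar)
    (hρt : ∀ t ∈ Icc 0 T, Tendsto (fun n => density (σ n t)) atTop (𝓝 (ρbar t)))
    (hψ : IsC1 ψ) {η : ℝ → ℝ} (hη : ContDiff ℝ 1 η) :
    ∫ᵛ p, η p.1 * ψ p.2 ∂•Jbar = ∫ t : Ioo (0 : ℝ) T,
      η t * (2⁻¹ * ∫ x, torusDeriv ψ x ∂(ρbar t : Measure UnitAddCircle)) ∂timeMeasure T := by
  have hd := hψ.continuous_torusDeriv
  obtain ⟨C, hC⟩ := exists_norm_le hψ.continuous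
  obtain ⟨C', hC'⟩ := exists_norm_le hd
  obtain ⟨M, hM⟩ := exists_bound_of_continuous T hη.continuous
  have hM' : ∀ t : Ioo (0 : ℝ) T, ‖η t‖ ≤ M := fun t => hM t (Ioo_subset_Icc_self t.2)
  have hηc : Continuous fun t : Ioo (0 : ℝ) T => η t := hη.continuous.comp continuous_subtype_val
  have hlimJ := hJ (BoundedContinuousFunction.ofNormedAddCommGroup
    (fun p : Ioo (0 : ℝ) T × UnitAddCircle => η p.1 * ψ p.2)
    ((hηc.comp continuous_fst).mul (hψ.continuous.comp continuous_snd)) (M * C) fun p => by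
      rw [norm_mul]
      exact mul_le_mul (hM' _) (hC _) (norm_nonneg _) ((norm_nonneg _).trans (hM' p.1)))
  simp only [BoundedContinuousFunction.coe_ofNormedAddCommGroup] at hlimJ
  -- Narrow convergence of `ρ^n_t` at each fixed time, dominated by a constant, passes to the limit
  -- under the time integral.
  have hlimρ : Tendsto (fun n => ∫ t : Ioo (0 : ℝ) T,
      η t * ∫ x, torusDeriv ψ x ∂(density (σ n t) : Measure UnitAddCircle) ∂timeMeasure T) atTop
      (𝓝 (∫ t : Ioo (0 : ℝ) T,
      η t * ∫ x, torusDeriv ψ x ∂(ρbar t : Measure UnitAddCircle) ∂timeMeasure T)) := by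
    refine tendsto_integral_of_dominated_convergence (fun _ => M * C') (fun n => ?_)
      (integrable_const _) (fun n => Eventually.of_forall fun t => ?_)
      (Eventually.of_forall fun t => ?_)
    · exact (hηc.measurable.mul (measurable_Ioo_of_continuousOn
        (continuousOn_integral_density (hCE n).continuousOn hd))).aestronglyMeasurable
    · have := norm_integral_le_of_norm_le_const
        (μ := (density (σ n t) : Measure UnitAddCircle)) (Eventually.of_forall hC')
      rw [norm_mul]
      simp only [probReal_univ, mul_one] at this
      exact mul_le_mul (hM' t) this (norm_nonneg _) ((norm_nonneg _).trans (hM' t))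
    · exact (ProbabilityMeasure.tendsto_iff_forall_integral_tendsto.1
        (hρt t (Ioo_subset_Icc_self t.2))
        (BoundedContinuousFunction.mkOfCompact ⟨_, hd⟩)).const_mul _
  have hzero : Tendsto (fun n => (∫ t : Ioo (0 : ℝ) T,
      η t * ∫ x, torusDeriv ψ x ∂(density (σ n t) : Measure UnitAddCircle) ∂timeMeasure T)
      - 2 * ∫ᵛ p, η p.1 * ψ p.2 ∂•(timeIntegral T fun t => derivedFlux (V n) (j n t))) atTop
      (𝓝 0) := by
    refine squeeze_zero_norm (fun n => abs_integral_weak_le hT (one_pos.trans_le (hV n)) (hCE n)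
      (hfin n) hψ hC hη) ?_
    simpa using (tendsto_inv_atTop_zero.comp hVlim).const_mul
      ((|η T| + ∫ t in (0 : ℝ)..T, |deriv η t|) * (2 * C))
  have huniq := tendsto_nhds_unique hzero (hlimρ.sub (hlimJ.const_mul 2))
  have : ∀ t : Ioo (0 : ℝ) T,
      η t * (2⁻¹ * ∫ x, torusDeriv ψ x ∂(ρbar t : Measure UnitAddCircle))
      = 2⁻¹ * (η t * ∫ x, torusDeriv ψ x ∂(ρbar t : Measure UnitAddCircle)) := fun t => by ring
  simp_rw [this]
  rw [integral_const_mul]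
  linarith

end Limit

/-- The slopes `∫ ∂ₓψ dρ̄_t` are integrable in time. -/
lemma integrable_limit {T : ℝ} {σ : ℕ → ℝ → ProbabilityMeasure Omega}
    (hσ : ∀ n, ContinuousOn (σ n) (Icc 0 T)) {ρbar : ℝ → ProbabilityMeasure UnitAddCircle}
    (hρt : ∀ t ∈ Icc 0 T, Tendsto (fun n => density (σ n t)) atTop (𝓝 (ρbar t)))
    {f : UnitAddCircle → ℝ} (hf : Continuous f) :
    Integrable (fun t : Ioo (0 : ℝ) T => ∫ x, f x ∂(ρbar t : Measure UnitAddCircle))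
      (timeMeasure T) := by
  obtain ⟨C, hC⟩ := exists_norm_le hf
  refine integrable_of_bounded (C := C) (measurable_of_tendsto_metrizable
    (fun n => measurable_Ioo_of_continuousOn (continuousOn_integral_density (hσ n) hf))
    (tendsto_pi_nhds.2 fun t => ProbabilityMeasure.tendsto_iff_forall_integral_tendsto.1
      (hρt t (Ioo_subset_Icc_self t.2)) (BoundedContinuousFunction.mkOfCompact ⟨f, hf⟩)))
    fun t => ?_
  simpa using norm_integral_le_of_norm_le_const (μ := (ρbar t : Measure UnitAddCircle))
    (Eventually.of_forall hC)

/-- Identification of the density in time of `∫ ψ(x) m_t(dx)`. -/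
lemma ae_eq_integral_section {X : Type*} [MeasurableSpace X] {T : ℝ} {J : ℝ → SignedMeasure X}
    (hJ : IsIntegrableFamily T J) {ψ : X → ℝ} (hψ : Measurable ψ) {C : ℝ} (hC : ∀ x, ‖ψ x‖ ≤ C)
    {g : Ioo (0 : ℝ) T → ℝ} (hg : Integrable g (timeMeasure T))
    (h : ∀ A : Set (Ioo (0 : ℝ) T), MeasurableSet A →
      ∫ᵛ p in A ×ˢ univ, ψ p.2 ∂•(timeIntegral T J) = ∫ t in A, g t ∂timeMeasure T) :
    ∀ᵐ t : Ioo (0 : ℝ) T ∂timeMeasure T, g t = ∫ᵛ x, ψ x ∂•(J t) := by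
  have hm : Measurable fun q : Ioo (0 : ℝ) T × X => ψ q.2 := hψ.comp measurable_snd
  refine hg.ae_eq_of_forall_setIntegral_eq _ _
    (integrable_integral_family (f := fun q : Ioo (0 : ℝ) T × X => ψ q.2) hJ hm fun q => hC q.2)
    fun A hA _ => ?_
  have hAu : MeasurableSet (A ×ˢ (univ : Set X)) := hA.prod MeasurableSet.univ
  rw [← h A hA, ← VectorMeasure.integral_indicator hAu,
    integral_timeIntegral hJ (hm.indicator hAu) (C := C) fun q =>
      (norm_indicator_le_norm_self _ _).trans (hC q.2), ← integral_indicator hA]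
  congr with t
  by_cases ht : t ∈ A <;> simp [ht, indicator]

end KacDiffusive

end
-- Density in time of the limit flux and regularity of the limit density
open KacDiffusive in
theorem lemma4p6 (α T : ℝ) (hα : 0 < α) (hT : 0 < T)
    -- the speeds, tending to infinity
    (V : ℕ → ℝ) (hV : ∀ n, 1 ≤ V n) (hVlim : Tendsto V atTop atTop)
    -- solutions of the continuity equation with bounded initial entropy and rate functional
    (σ : ℕ → ℝ → ProbabilityMeasure Omega) (j : ℕ → ℝ → Flux)
    (hCE : ∀ n, ContinuityEq T (σ n) (j n))
    (C : ℝ)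
    (hC : ∀ n, InformationTheory.klDiv (σ n 0 : Measure Omega) statMeasure
      + rateFunctional α T (V n) (σ n) (j n) ≤ ENNReal.ofReal C)
    -- the limits
    (ρbar : ℝ → ProbabilityMeasure UnitAddCircle)
    (ωbar Jbar : SignedMeasure (Ioo (0 : ℝ) T × UnitAddCircle))
    (hρ : NarrowTendsto (fun n => timeIntegral T fun t => toSigned (density (σ n t)))
      (timeIntegral T fun t => toSigned (ρbar t)))
    (hω : NarrowTendsto (fun n => timeIntegral T fun t => fluxOf (V n) (σ n t)) ωbar)
    (hJ : NarrowTendsto (fun n => timeIntegral T fun t => derivedFlux (V n) (j n t)) Jbar)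
    (hρt : ∀ t ∈ Icc 0 T, Tendsto (fun n => density (σ n t)) atTop (𝓝 (ρbar t))) :
    -- `Jbar` has a density in time, and the claims hold for every version of this density
    (∃ J : ℝ → SignedMeasure UnitAddCircle, IsIntegrableFamily T J ∧ Jbar = timeIntegral T J) ∧
    ∀ J : ℝ → SignedMeasure UnitAddCircle, IsIntegrableFamily T J → Jbar = timeIntegral T J →
      ∀ᵐ t ∂(volume.restrict (Ioo 0 T)),
        (∀ ψ : UnitAddCircle → ℝ, IsC1 ψ →
          (∫ x, torusDeriv ψ x ∂(ρbar t : Measure UnitAddCircle)) - 2 * ∫ᵛ x, ψ x ∂•(J t) = 0) ∧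
        (ρbar t : Measure UnitAddCircle) ≪ volume ∧
        HasDistribDeriv (lebDensity (ρbar t)) (-(2 : ℝ) • J t) ∧
        IsBV (lebDensity (ρbar t)) := by
  have hfin : ∀ n, rateFunctional α T (V n) (σ n) (j n) < ∞ := fun n =>
    (le_add_self.trans (hC n)).trans_lt ENNReal.ofReal_lt_top
  have hint : ∀ ψ : UnitAddCircle → ℝ, IsC1 ψ → Integrable (fun t : Ioo (0 : ℝ) T =>
      2⁻¹ * ∫ x, torusDeriv ψ x ∂(ρbar t : Measure UnitAddCircle)) (timeMeasure T) :=
    fun ψ hψ => (integrable_limit (fun n => (hCE n).continuousOn) hρt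
      hψ.continuous_torusDeriv).const_mul _
  have hset : ∀ ψ : UnitAddCircle → ℝ, IsC1 ψ → ∀ A : Set (Ioo (0 : ℝ) T), MeasurableSet A →
      ∫ᵛ p in A ×ˢ univ, ψ p.2 ∂•Jbar = ∫ t in A,
        2⁻¹ * ∫ x, torusDeriv ψ x ∂(ρbar t : Measure UnitAddCircle) ∂timeMeasure T := by
    intro ψ hψ A hA
    obtain ⟨K, hK⟩ := exists_norm_le hψ.continuous
    exact integral_indicator_mul_eq hψ.continuous.measurable hK (hint ψ hψ)
      (fun η hη => integral_limit_eq hT hV hVlim hCE hfin hJ hρt hψ hη) hA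
  refine ⟨exists_timeIntegral_eq fun A B hA hB h0 => ?_, fun J hJi hJeq => ?_⟩
  · have hAu : MeasurableSet (A ×ˢ (univ : Set UnitAddCircle)) := hA.prod MeasurableSet.univ
    -- The spatial measure `J̄(A × ·)` pairs with each `ψ ∈ C¹` to an integral over the null set
    -- `A`, hence is zero.
    have hzero : (Jbar.restrict (A ×ˢ univ)).map Prod.snd = 0 := by
      refine signedMeasure_eq_zero_of_c1 fun ψ hψ => ?_
      obtain ⟨K, hK⟩ := exists_norm_le hψ.continuous
      rw [VectorMeasure.integral_map measurable_snd hψ.continuous.measurable.aestronglyMeasurable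
        (integrable_of_bounded (hψ.continuous.measurable.comp measurable_snd) fun p => hK _),
        hset ψ hψ A hA, Measure.restrict_eq_zero.2 h0, integral_zero_measure]
    have h1 := congrArg (fun m : SignedMeasure UnitAddCircle => m B) hzero
    have hAB : (Prod.snd ⁻¹' B ∩ A ×ˢ univ : Set (Ioo (0 : ℝ) T × UnitAddCircle)) = A ×ˢ B := by
      ext p
      simp [and_comm]
    rw [VectorMeasure.map_apply _ measurable_snd hB, VectorMeasure.restrict_apply _ hAu
      (measurable_snd hB), hAB] at h1
    exact h1
  · obtain ⟨D, hDc, hD, hall⟩ := exists_countable_c1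
    -- Each `ψ` has its own exceptional null set of times; countability of `D` permits taking their
    -- union.
    have hae : ∀ᵐ t : Ioo (0 : ℝ) T ∂timeMeasure T, ∀ ψ ∈ D,
        2⁻¹ * ∫ x, torusDeriv ψ x ∂(ρbar t : Measure UnitAddCircle) = ∫ᵛ x, ψ x ∂•(J t) := by
      rw [ae_ball_iff hDc]
      intro ψ hψD
      have hψ := hD ψ hψD
      obtain ⟨K, hK⟩ := exists_norm_le hψ.continuous
      refine ae_eq_integral_section hJi hψ.continuous.measurable hK (hint ψ hψ) fun A hA => ?_
      rw [← hJeq]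
      exact hset ψ hψ A hA
    have hae' : ∀ᵐ t ∂(volume.restrict (Ioo 0 T)), ∀ ψ ∈ D,
        2⁻¹ * ∫ x, torusDeriv ψ x ∂(ρbar t : Measure UnitAddCircle) = ∫ᵛ x, ψ x ∂•(J t) :=
      (ae_restrict_iff_subtype measurableSet_Ioo).2 hae
    filter_upwards [hae'] with t ht
    have hweak : ∀ ψ : UnitAddCircle → ℝ, IsC1 ψ →
        ∫ x, torusDeriv ψ x ∂(ρbar t : Measure UnitAddCircle) = ∫ᵛ x, ψ x ∂•((2 : ℝ) • J t) := by
      -- At a fixed good time the identity extends from `D` to all of `C¹`, with the factor 2 placed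
      -- in the second measure.
      have := hall (toSigned (ρbar t)) ((2 : ℝ) • J t)
      simp only [toSigned, integral_toSignedMeasure_lsmul] at this
      refine this fun ψ hψ => ?_
      rw [VectorMeasure.integral_smul_vectorMeasure, ← ht ψ hψ, smul_eq_mul]
      ring
    have hac := absolutelyContinuous_of_deriv (ρbar t) _ hweak
    have hdistrib : HasDistribDeriv (lebDensity (ρbar t)) (-(2 : ℝ) • J t) := fun ψ hψ => by
      rw [integral_lebDensity hac, hweak ψ hψ, VectorMeasure.integral_smul_vectorMeasure,
        VectorMeasure.integral_smul_vectorMeasure, smul_eq_mul, smul_eq_mul]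
      ring
    refine ⟨fun ψ hψ => ?_, hac, hdistrib, integrable_lebDensity _, _, hdistrib⟩
    rw [hweak ψ hψ, VectorMeasure.integral_smul_vectorMeasure, smul_eq_mul, sub_self]
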